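/- Let $\mathcal{G}$ be a comeager subset of Cantor space $2^\omega$, that is, a set containing a countable intersection of dense open sets. Then there exists a weakly 2-random sequence $X \in 2^\omega$ that computes (i.e. is Turing above) some $Y \in \mathcal{G}$. Here a $\Pi^0_2$ set is an intersection $\bigcap_n \mathcal{U}_n$ of a uniformly effectively open sequence $(\mathcal{U}_n)_{n\in\omega}$ of subsets of $2^\omega$ (there is a computably enumerable set $W \subseteq \omega \times 2^{<\omega}$ such that $\mathcal{U}_n$ is the set of all $Z \in 2^\omega$ having a prefix $\sigma$ with $(n,\sigma)\in W$), and $X$ is weakly 2-random if it belongs to no $\Pi^0_2$ set of measure zero for the uniform (fair-coin) measure on $2^\omega$. -/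

import Mathlib

open MeasureTheory

namespace CantorSpace

/-- Cantor space `2^ω` with its product topology and product σ-algebra. -/
abbrev Cantor : Type := ℕ → Bool

/-- The basic clopen set `[σ]` of all infinite sequences that extend the finite string `σ`. -/
def basicOpen (σ : List Bool) : Set Cantor :=
  {X | ∀ i : Fin σ.length, X i = σ.get i}

/-- The uniform (Lebesgue, fair-coin) measure on Cantor space: the product over all positions
of the uniform probability measure on `{0,1}`. -/
noncomputable def uniformMeasure : Measure Cantor :=
  Measure.infinitePi fun _ : ℕ => (PMF.uniformOfFintype Bool).toMeasure

/-- A sequence of uniformly effectively open (`Σ⁰₁`) sets: for a c.e. relation `W` between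
numbers and strings, `U n` is the union of the basic open sets `[σ]` with `W n σ`. -/
def UniformlyEffectivelyOpen (U : ℕ → Set Cantor) : Prop :=
  ∃ W : ℕ → List Bool → Prop,
    REPred (fun p : ℕ × List Bool => W p.1 p.2) ∧
      ∀ n, U n = {X | ∃ σ, W n σ ∧ X ∈ basicOpen σ}

/-- A (lightface) `Π⁰₂` class: the intersection of a uniformly effectively open sequence. -/
def IsPi02 (A : Set Cantor) : Prop :=
  ∃ U : ℕ → Set Cantor, UniformlyEffectivelyOpen U ∧ A = ⋂ n, U n

/-- `X` is weakly 2-random if it belongs to no `Π⁰₂` set of uniform measure zero. -/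
def WeaklyTwoRandom (X : Cantor) : Prop :=
  ∀ A : Set Cantor, IsPi02 A → uniformMeasure A = 0 → X ∉ A

/-- The characteristic function of `X`, a total function with values in `{0,1}`. -/
def charFun (X : Cantor) : ℕ →. ℕ := fun n => Part.some (X n).toNat

/-- `X` computes `Y`, i.e. `Y` is Turing reducible to `X`. -/
def Computes (X Y : Cantor) : Prop :=
  TuringReducible (charFun Y) (charFun X)

end CantorSpace

/-! The complement of a `Π⁰₂` set is an increasing union of effectively closed sets. If the `Π⁰₂`
set is null, these closed sets have measures tending to `1`, so a sequence escapes it by being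
trapped in one of them. The sequence `X` is built inside such closed sets, one for each null index,
while coding bits for a fixed machine `run` that outputs `Y`.

Coding uses measure. If the closed set in use has mass at least `2 ^ (-c)` above the current string,
then two strings of length `c + 1` carry a controlled share of that mass (`exists_two_extensions`).
The first and the last such string code the two digits (`Good.exists_decoded`).

The machine does not know which closed set the builder of `X` has chosen, so it tries guesses `0, 1,
2, ...`. Each guess comes with a belief that some mass is at least `2 ^ (-loss)`. Masses of closed
sets are approximated from above by finite counts, so a false belief is eventually refuted and a
true one never is. The refutation stage is the same for all oracles above the current string
(`exists_stage_guess`). The builder, who need not be effective, waits until then and picks a string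
still carrying mass (`Good.exists_good`).

Wrong guesses may have produced junk output, which cannot be retracted. This is harmless for
genericity: every finite string extends into the next dense open set, and the builder codes that
extension next (`Ready.exists_next`). The limit gives `X` and `Y` (`exists_trapped_generic`). -/

namespace CantorSpace

/-! ### Strings, cylinders and the uniform measure -/

/-- The initial segment of length `s` of a sequence. -/
def seg (X : Cantor) (s : ℕ) : List Bool := (List.range s).map X

@[simp] lemma length_seg (X : Cantor) (s : ℕ) : (seg X s).length = s := by simp [seg]

lemma seg_succ (X : Cantor) (s : ℕ) : seg X (s + 1) = seg X s ++ [X s] := by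
  simp [seg, List.range_succ]

lemma getElem_seg (X : Cantor) (s i : ℕ) (h : i < (seg X s).length) : (seg X s)[i] = X i := by
  simp [seg]

lemma take_seg (X : Cantor) {i s : ℕ} (h : i ≤ s) : (seg X s).take i = seg X i := by
  apply List.ext_getElem
  · simp [h]
  · intro j h1 h2
    simp [seg]

lemma seg_prefix_seg (X : Cantor) {i s : ℕ} (h : i ≤ s) : seg X i <+: seg X s := by
  rw [← take_seg X h]; exact List.take_prefix _ _

lemma mem_basicOpen_iff {X : Cantor} {σ : List Bool} :
    X ∈ basicOpen σ ↔ seg X σ.length = σ := by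
  constructor
  · intro h
    apply List.ext_getElem (by simp)
    intro i h1 h2
    rw [getElem_seg]
    exact h ⟨i, h2⟩
  · intro h i
    have : σ.get i = (seg X σ.length)[i.1]'(by simp) := by simp only [h]; rfl
    rw [this, getElem_seg]

lemma mem_basicOpen_iff_prefix {X : Cantor} {σ : List Bool} {s : ℕ} (hs : σ.length ≤ s) :
    X ∈ basicOpen σ ↔ σ <+: seg X s := by
  rw [mem_basicOpen_iff, List.prefix_iff_eq_take, take_seg X hs, eq_comm]

lemma mem_basicOpen_seg (X : Cantor) (s : ℕ) : X ∈ basicOpen (seg X s) := by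
  rw [mem_basicOpen_iff, length_seg]

lemma basicOpen_anti {σ τ : List Bool} (h : σ <+: τ) : basicOpen τ ⊆ basicOpen σ := by
  intro X hX
  rw [mem_basicOpen_iff] at hX
  rw [mem_basicOpen_iff_prefix h.length_le, hX]
  exact h

lemma basicOpen_eq_pi (σ : List Bool) :
    basicOpen σ = Set.pi (Finset.range σ.length : Set ℕ) fun i => {σ.getD i false} := by
  ext X
  constructor
  · intro h i hi
    have hi' : i < σ.length := by simpa using hi
    have := h ⟨i, hi'⟩
    simp [this, hi']
  · intro h i
    have := h i (by simp)
    simpa using this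

instance : IsProbabilityMeasure uniformMeasure := by
  unfold uniformMeasure; infer_instance

lemma uniformMeasure_basicOpen (σ : List Bool) :
    uniformMeasure.real (basicOpen σ) = (1 / 2 : ℝ) ^ σ.length := by
  have hb (b : Bool) : (PMF.uniformOfFintype Bool).toMeasure {b} = (2 : ENNReal)⁻¹ := by
    rw [PMF.toMeasure_apply_singleton _ _ (MeasurableSet.singleton b)]
    simp
  rw [Measure.real, basicOpen_eq_pi, uniformMeasure, Measure.infinitePi_pi]
  · simp [hb]
  · intro i _; exact MeasurableSet.singleton _

lemma measurableSet_basicOpen (σ : List Bool) : MeasurableSet (basicOpen σ) := by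
  rw [basicOpen_eq_pi]
  exact MeasurableSet.pi (Set.to_countable _) fun i _ => MeasurableSet.singleton _

lemma measurableSet_seg (p : List Bool → Prop) (s : ℕ) :
    MeasurableSet {X : Cantor | p (seg X s)} := by
  have : {X : Cantor | p (seg X s)} = ⋃ σ ∈ {σ | p σ ∧ σ.length = s}, basicOpen σ := by
    ext X
    simp only [Set.mem_iUnion, Set.mem_ofPred_eq, exists_prop]
    constructor
    · intro h; exact ⟨_, ⟨h, length_seg X s⟩, mem_basicOpen_seg X s⟩
    · rintro ⟨σ, ⟨h, hl⟩, hX⟩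
      rw [mem_basicOpen_iff, hl] at hX
      rwa [hX]
  rw [this]
  exact MeasurableSet.biUnion (Set.to_countable _) fun σ _ => measurableSet_basicOpen σ

/-- All binary strings of a given length, in lexicographic order. -/
def strings : ℕ → List (List Bool)
  | 0 => [[]]
  | n + 1 => (strings n).flatMap fun l => [l ++ [false], l ++ [true]]

@[simp] lemma mem_strings {n : ℕ} {σ : List Bool} : σ ∈ strings n ↔ σ.length = n := by
  induction n generalizing σ with
  | zero => simp [strings]
  | succ n ih =>
    simp only [strings, List.mem_flatMap, ih, List.mem_cons, List.not_mem_nil, or_false]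
    constructor
    · rintro ⟨a, ha, rfl | rfl⟩ <;> simp [ha]
    · intro h
      have hne : σ ≠ [] := by rintro rfl; simp at h
      refine ⟨σ.dropLast, by simp [h], ?_⟩
      have := List.dropLast_append_getLast hne
      cases hb : σ.getLast hne <;> rw [hb] at this <;> simp [this]

lemma nodup_strings (n : ℕ) : (strings n).Nodup := by
  induction n with
  | zero => simp [strings]
  | succ n ih =>
    rw [strings, List.nodup_flatMap]
    refine ⟨fun x _ => by simp, ih.imp ?_⟩
    intro a b hab x hx hy
    simp only [List.mem_cons, List.not_mem_nil, or_false] at hx hy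
    apply hab
    have h1 : a = x.dropLast := by rcases hx with rfl | rfl <;> simp
    have h2 : b = x.dropLast := by rcases hy with rfl | rfl <;> simp
    rw [h1, h2]

lemma length_strings (n : ℕ) : (strings n).length = 2 ^ n := by
  induction n with
  | zero => simp [strings]
  | succ n ih => simp [strings, List.length_flatMap, ih, pow_succ]

lemma measureReal_eq_card {A : Set Cantor} {L : List (List Bool)} {s : ℕ} (hn : L.Nodup)
    (hL : ∀ σ ∈ L, σ.length = s) (hA : ∀ X, X ∈ A ↔ seg X s ∈ L) :
    uniformMeasure.real A = L.length * (1 / 2 : ℝ) ^ s := by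
  have h1 : A = ⋃ σ ∈ L.toFinset, basicOpen σ := by
    ext X
    simp only [Set.mem_iUnion, hA, List.mem_toFinset, exists_prop]
    constructor
    · intro h; exact ⟨_, h, mem_basicOpen_seg X s⟩
    · rintro ⟨σ, h, hX⟩
      rw [mem_basicOpen_iff, hL σ h] at hX
      rwa [hX]
  rw [h1, measureReal_biUnion_finset, ← List.toFinset_card_of_nodup hn]
  · rw [← nsmul_eq_mul, ← Finset.sum_const]
    refine Finset.sum_congr rfl fun σ hσ => ?_
    rw [uniformMeasure_basicOpen, hL σ (by simpa using hσ)]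
  · intro σ hσ τ hτ hne
    refine Set.disjoint_left.2 fun X h1 h2 => hne ?_
    rw [mem_basicOpen_iff, hL σ (by simpa using hσ)] at h1
    rw [mem_basicOpen_iff, hL τ (by simpa using hτ)] at h2
    rw [← h1, h2]
  · intro σ _
    exact measurableSet_basicOpen σ

/-! ### Tree families and the mass of their paths -/

/-- A family of binary trees `T e n`, increasing in `n`, with `T 0 n` the full tree. -/
structure TreeFamily (T : ℕ → ℕ → List Bool → Bool) : Prop where
  zero : ∀ n σ, T 0 n σ = true
  mono : ∀ e n m σ, n ≤ m → T e n σ = true → T e m σ = true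
  closed : ∀ e n σ τ, σ <+: τ → T e n τ = true → T e n σ = true

/-- A record `((mode, requirement, guess), (base, loss, start))` of the decoding machine. -/
abbrev Entry : Type := (ℕ × ℕ × ℕ) × (ℕ × ℕ × ℕ)

namespace Entry

/-- The number of zeros decoded since the last one. -/
abbrev mode (x : Entry) : ℕ := x.1.1
/-- The index of the family of trees in use. -/
abbrev req (x : Entry) : ℕ := x.1.2.1
/-- The current guess: the tree in use is `T x.req x.guess`. -/
abbrev guess (x : Entry) : ℕ := x.1.2.2
/-- The position at which the record was created. -/
abbrev base (x : Entry) : ℕ := x.2.1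
/-- The set above the base position is believed to have measure at least `2 ^ (-x.loss)`. -/
abbrev loss (x : Entry) : ℕ := x.2.2.1
/-- The position at which the current guess was made. -/
abbrev start (x : Entry) : ℕ := x.2.2.2

end Entry

variable (T : ℕ → ℕ → List Bool → Bool)

/-- `σ` lies on all trees in use. -/
def alive (S : List Entry) (σ : List Bool) : Bool := S.all fun x => T x.req x.guess σ

/-- The number of strings of length `s` extending `ρ` that lie on all trees in use. -/
def count (S : List Entry) (ρ : List Bool) (s : ℕ) : ℕ :=
  ((strings s).filter fun ν => decide (ρ = ν.take ρ.length) && alive T S ν).length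

/-- The measure of the set of paths through `ρ` on all trees in use. -/
noncomputable def mass (S : List Entry) (ρ : List Bool) : ℝ :=
  uniformMeasure.real ({X | ∀ s, alive T S (seg X s) = true} ∩ basicOpen ρ)

variable {T}

lemma alive_closed (hT : TreeFamily T) {S : List Entry} {σ τ : List Bool} (h : σ <+: τ)
    (ha : alive T S τ = true) : alive T S σ = true := by
  simp only [alive, List.all_eq_true] at ha ⊢
  exact fun x hx => hT.closed _ _ _ _ h (ha x hx)

lemma measureReal_alive (S : List Entry) {ρ : List Bool} {s : ℕ} (hs : ρ.length ≤ s) :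
    uniformMeasure.real ({X | alive T S (seg X s) = true} ∩ basicOpen ρ) =
      count T S ρ s * (1 / 2 : ℝ) ^ s := by
  refine measureReal_eq_card ((nodup_strings s).filter _) (fun σ hσ => ?_) fun X => ?_
  · simpa using (List.mem_filter.1 hσ).1
  · simp [mem_basicOpen_iff_prefix hs, List.prefix_iff_eq_take, and_comm]

lemma mass_le_count (S : List Entry) {ρ : List Bool} {s : ℕ} (hs : ρ.length ≤ s) :
    mass T S ρ ≤ count T S ρ s * (1 / 2 : ℝ) ^ s := by
  rw [← measureReal_alive S hs]
  exact measureReal_mono (Set.inter_subset_inter_left _ fun X hX => hX s) (measure_ne_top _ _)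

/-- Continuity from above: the level-`s` approximations decrease to the set of paths. This is what
makes a false lower bound on mass visible at a finite stage. -/
lemma eventually_count_lt (hT : TreeFamily T) {S : List Entry} {ρ : List Bool} {a : ℝ}
    (h : mass T S ρ < a) :
    ∀ᶠ s in Filter.atTop, count T S ρ s * (1 / 2 : ℝ) ^ s < a := by
  have hanti : Antitone fun s => {X | alive T S (seg X s) = true} ∩ basicOpen ρ := by
    intro s t hst
    exact Set.inter_subset_inter_left _ fun X hX => alive_closed hT (seg_prefix_seg X hst) hX
  have hlim := tendsto_measure_iInter_atTop (μ := uniformMeasure)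
    (fun s => ((measurableSet_seg (fun σ => alive T S σ = true) s).inter
      (measurableSet_basicOpen ρ)).nullMeasurableSet) hanti ⟨0, measure_ne_top _ _⟩
  have heq : ⋂ s, ({X | alive T S (seg X s) = true} ∩ basicOpen ρ) =
      {X | ∀ s, alive T S (seg X s) = true} ∩ basicOpen ρ := by
    rw [← Set.iInter_inter]
    congr 1
    ext X; simp
  rw [heq] at hlim
  have hlim' := (ENNReal.tendsto_toReal (measure_ne_top _ _)).comp hlim
  filter_upwards [hlim'.eventually_lt_const h, Filter.eventually_ge_atTop ρ.length] with s hs hl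
  rw [← measureReal_alive S hl]
  exact hs

lemma mass_le (S : List Entry) (ρ : List Bool) : mass T S ρ ≤ (1 / 2 : ℝ) ^ ρ.length := by
  rw [← uniformMeasure_basicOpen]
  exact measureReal_mono Set.inter_subset_right (measure_ne_top _ _)

lemma alive_of_mass_pos {S : List Entry} {ρ : List Bool} (h : 0 < mass T S ρ) :
    alive T S ρ = true := by
  have : ({X | ∀ s, alive T S (seg X s) = true} ∩ basicOpen ρ).Nonempty := by
    by_contra hne
    rw [Set.not_nonempty_iff_eq_empty] at hne
    simp [mass, hne] at h
  obtain ⟨X, hX, hρ⟩ := this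
  rw [mem_basicOpen_iff] at hρ
  rw [← hρ]; exact hX _

/-! ### Distribution of mass among extensions -/

/-- The extensions of `ρ` of length `l`. -/
def extensions (ρ : List Bool) (l : ℕ) : List (List Bool) :=
  (strings l).filter fun ν => decide (ρ = ν.take ρ.length)

lemma mem_extensions {ρ ν : List Bool} {l : ℕ} :
    ν ∈ extensions ρ l ↔ ν.length = l ∧ ρ <+: ν := by
  simp [extensions, List.prefix_iff_eq_take]

lemma mass_le_sum (S : List Entry) {ρ : List Bool} {l : ℕ} (hl : ρ.length ≤ l) :
    mass T S ρ ≤ ∑ ν ∈ (extensions ρ l).toFinset, mass T S ν := by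
  refine le_trans (measureReal_mono ?_ (measure_ne_top _ _)) (measureReal_biUnion_finset_le _ _)
  rintro X ⟨hX, hρ⟩
  simp only [Set.mem_iUnion]
  refine ⟨seg X l, ?_, hX, mem_basicOpen_seg X l⟩
  simp [mem_extensions, (mem_basicOpen_iff_prefix hl).1 hρ]

lemma card_extensions_le (ρ : List Bool) (l : ℕ) :
    ((extensions ρ l).toFinset.card : ℝ) ≤ 2 ^ l := by
  have : (extensions ρ l).toFinset.card ≤ 2 ^ l := by
    rw [← length_strings]
    exact (List.toFinset_card_le _).trans (List.length_filter_le _ _)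
  exact_mod_cast this

/-- Pigeonhole: at most `2 ^ l` strings share the mass, so one of them gets a `2 ^ (-l)` fraction.
-/
lemma exists_extension_mass {S : List Entry} {ρ : List Bool} {c l : ℕ} (hl : ρ.length ≤ l)
    (h : (1 / 2 : ℝ) ^ c ≤ mass T S ρ) :
    ∃ ν, ρ <+: ν ∧ ν.length = l ∧ (1 / 2 : ℝ) ^ (c + l) ≤ mass T S ν := by
  by_contra! hcon
  have hpos : (0 : ℝ) < mass T S ρ := lt_of_lt_of_le (by positivity) h
  have hne : (extensions ρ l).toFinset.Nonempty := by
    by_contra hne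
    have := mass_le_sum (T := T) S hl
    rw [Finset.not_nonempty_iff_eq_empty.1 hne] at this
    simp at this
    linarith
  have h1 : ∑ ν ∈ (extensions ρ l).toFinset, mass T S ν <
      ∑ ν ∈ (extensions ρ l).toFinset, (1 / 2 : ℝ) ^ (c + l) := by
    refine Finset.sum_lt_sum_of_nonempty hne fun ν hν => ?_
    obtain ⟨h1, h2⟩ := mem_extensions.1 (List.mem_toFinset.1 hν)
    exact hcon ν h2 h1
  have h2 : ∑ ν ∈ (extensions ρ l).toFinset, (1 / 2 : ℝ) ^ (c + l) ≤ (1 / 2 : ℝ) ^ c := by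
    rw [Finset.sum_const, nsmul_eq_mul]
    calc _ ≤ (2 : ℝ) ^ l * (1 / 2 : ℝ) ^ (c + l) := by
          gcongr; exact card_extensions_le ρ l
      _ = (1 / 2 : ℝ) ^ c * (2 * (1 / 2 : ℝ)) ^ l := by rw [mul_pow]; ring
      _ = _ := by norm_num
  linarith [mass_le_sum (T := T) S hl]

/-- Two different extensions of `ρ` of length `c + 1` carry a controlled part of the mass. -/
lemma exists_two_extensions {S : List Entry} {ρ : List Bool} {c : ℕ} (hl : ρ.length ≤ c + 1)
    (h : (1 / 2 : ℝ) ^ c ≤ mass T S ρ) :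
    ∃ ν ∈ extensions ρ (c + 1), ∃ ν' ∈ extensions ρ (c + 1), ν ≠ ν' ∧
      (1 / 2 : ℝ) ^ (2 * c + 2) ≤ mass T S ν ∧ (1 / 2 : ℝ) ^ (2 * c + 2) ≤ mass T S ν' := by
  obtain ⟨ν, h1, h2, h3⟩ := exists_extension_mass hl h
  have hν : ν ∈ extensions ρ (c + 1) := mem_extensions.2 ⟨h2, h1⟩
  have h3' : (1 / 2 : ℝ) ^ (2 * c + 2) ≤ mass T S ν :=
    le_trans (pow_le_pow_of_le_one (by norm_num) (by norm_num) (by omega)) h3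
  by_contra! hcon
  -- If `ν` were the only heavy string, it would contribute at most `2 ^ (-(c + 1))` and the others
  -- together less than `2 ^ (c + 1) * 2 ^ (-(2 * c + 2)) = 2 ^ (-(c + 1))`, a total below `2 ^
  -- (-c)`.
  have hsum := mass_le_sum (T := T) S hl
  rw [← Finset.add_sum_erase _ _ (List.mem_toFinset.2 hν)] at hsum
  have hm := mass_le (T := T) S ν
  rw [h2] at hm
  have hbound : ∀ ν' ∈ (extensions ρ (c + 1)).toFinset.erase ν,
      mass T S ν' ≤ (1 / 2 : ℝ) ^ (2 * c + 2) := by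
    intro ν' hν'
    rw [Finset.mem_erase, List.mem_toFinset] at hν'
    exact (hcon ν hν ν' hν'.2 hν'.1.symm h3').le
  have h4 := Finset.sum_le_card_nsmul _ _ _ hbound
  rw [Finset.card_erase_of_mem (List.mem_toFinset.2 hν), nsmul_eq_mul] at h4
  have hcard := card_extensions_le ρ (c + 1)
  have hpos : 0 < (extensions ρ (c + 1)).toFinset.card :=
    Finset.card_pos.2 ⟨ν, List.mem_toFinset.2 hν⟩
  rw [Nat.cast_sub hpos] at h4
  have hp : (0 : ℝ) < (1 / 2 : ℝ) ^ (2 * c + 2) := by positivity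
  have h5 : ((extensions ρ (c + 1)).toFinset.card - (1 : ℕ) : ℝ) * (1 / 2 : ℝ) ^ (2 * c + 2) <
      2 ^ (c + 1) * (1 / 2 : ℝ) ^ (2 * c + 2) := by
    apply mul_lt_mul_of_pos_right _ hp
    push_cast; linarith
  have h6 : (2 : ℝ) ^ (c + 1) * (1 / 2 : ℝ) ^ (2 * c + 2) = (1 / 2 : ℝ) ^ (c + 1) := by
    have : (2 : ℝ) ^ (c + 1) * (1 / 2 : ℝ) ^ (c + 1) = 1 := by rw [← mul_pow]; norm_num
    calc (2 : ℝ) ^ (c + 1) * (1 / 2 : ℝ) ^ (2 * c + 2)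
        = ((2 : ℝ) ^ (c + 1) * (1 / 2 : ℝ) ^ (c + 1)) * (1 / 2 : ℝ) ^ (c + 1) := by ring
      _ = _ := by rw [this, one_mul]
  have h7 : (1 / 2 : ℝ) ^ (c + 1) + (1 / 2 : ℝ) ^ (c + 1) = (1 / 2 : ℝ) ^ c := by ring
  linarith

/-- The tree family with index `e` has only a null set of sequences leaving all its trees. -/
def NullIndex (T : ℕ → ℕ → List Bool → Bool) (e : ℕ) : Prop :=
  uniformMeasure {X | ∀ n, ∃ s, T e n (seg X s) = false} = 0

/-- Continuity from below: the path sets of `T e n` increase with `n` to a set of full measure, so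
intersecting with them loses arbitrarily little mass. The strict inequality leaves room for this
loss. -/
lemma exists_guess (hT : TreeFamily T) {e : ℕ} (he : NullIndex T e) {S : List Entry}
    {ρ : List Bool} {a : ℝ} (h : a < mass T S ρ) (k p c q : ℕ) :
    ∃ n, a < mass T (((k, e, n), (p, c, q)) :: S) ρ := by
  set Q := {X | ∀ s, alive T S (seg X s) = true} ∩ basicOpen ρ with hQ
  let E : ℕ → Set Cantor := fun n => {X | ∀ s, T e n (seg X s) = true}
  have hE (n : ℕ) : {X | ∀ s, alive T (((k, e, n), (p, c, q)) :: S) (seg X s) = true} ∩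
      basicOpen ρ = E n ∩ Q := by
    ext X
    simp only [hQ, E, alive, List.all_cons, Bool.and_eq_true, Set.mem_inter_iff,
      Set.mem_ofPred_eq, forall_and]
    tauto
  have hmono : Monotone fun n => E n ∩ Q := by
    intro n m hnm
    exact Set.inter_subset_inter_left _ fun X hX s => hT.mono _ _ _ _ hnm (hX s)
  have hlim := tendsto_measure_iUnion_atTop (μ := uniformMeasure) hmono
  have hU : uniformMeasure (⋃ n, E n ∩ Q) = uniformMeasure Q := by
    apply le_antisymm
    · exact measure_mono (Set.iUnion_subset fun n => Set.inter_subset_right)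
    · calc uniformMeasure Q ≤ uniformMeasure ((⋃ n, E n ∩ Q) ∪
            {X | ∀ n, ∃ s, T e n (seg X s) = false}) := by
            apply measure_mono
            intro X hX
            by_cases hc : ∃ n, ∀ s, T e n (seg X s) = true
            · obtain ⟨n, hn⟩ := hc
              exact Or.inl (Set.mem_iUnion.2 ⟨n, hn, hX⟩)
            · right
              push Not at hc
              simpa using hc
        _ ≤ _ + _ := measure_union_le _ _
        _ = _ := by rw [show uniformMeasure {X | ∀ n, ∃ s, T e n (seg X s) = false} = 0 from he,
                      add_zero]
  rw [hU] at hlim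
  have hlim' := (ENNReal.tendsto_toReal (measure_ne_top _ _)).comp hlim
  obtain ⟨n, hn⟩ := (hlim'.eventually_const_lt (show a < (uniformMeasure Q).toReal from h)).exists
  refine ⟨n, ?_⟩
  rw [mass, hE]
  exact hn

lemma mass_cons_zero (hT : TreeFamily T) (S : List Entry) (ρ : List Bool) (x : Entry)
    (hx : x.req = 0) : mass T (x :: S) ρ = mass T S ρ := by
  simp [mass, alive, hx, hT.zero]

lemma mass_cons_guess {S : List Entry} {ρ : List Bool} {x y : Entry} (h : x.req = y.req)
    (h' : x.guess = y.guess) : mass T (x :: S) ρ = mass T (y :: S) ρ := by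
  simp only [mass, alive, List.all_cons, h, h']

/-! ### The decoding machine -/

variable (T)

/-- The belief attached to the top record has been refuted at stage `ν.length`. -/
def refuted (S : List Entry) (ν : List Bool) : Bool :=
  decide (count T S (ν.take S.headI.base) ν.length * 2 ^ S.headI.loss < 2 ^ ν.length)

/-- Replace the guess of a record by the next one. -/
def nextGuess (x : Entry) (s : ℕ) : Entry :=
  ((x.mode, x.req, x.guess + 1), (x.base, x.loss, s))

/-- Find the lowest refuted record (if any), update its guess and delete everything above it.
The flag tells whether there was such a record. -/
def revise (S : List Entry) (ν : List Bool) : List Entry × Bool :=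
  -- The head of the list is the top of the stack, so `foldr` visits the bottom record first; once
  -- the flag is set, higher records are dropped.
  S.foldr (fun x acc =>
    if acc.2 = true then acc
    else if refuted T (x :: acc.1) ν = true then (nextGuess x ν.length :: acc.1, true)
    else (x :: acc.1, false)) ([], false)

/-- The exponent governing the coding length of the next bit. -/
def depth (S : List Entry) : ℕ := S.headI.loss + S.headI.start

/-- The strings of the coding length that still seem to carry enough measure. -/
def candidates (S : List Entry) (ν : List Bool) : List (List Bool) :=
  (extensions (ν.take S.headI.start) (depth S + 1)).filter fun μ =>
    decide (2 ^ ν.length ≤ count T S μ ν.length * 2 ^ (2 * depth S + 2))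

/-- The record created when the bit `b` is decoded. -/
def newEntry (b : Bool) (S : List Entry) (s : ℕ) : Entry :=
  -- A one after `k` zeros calls family `k - 1`. For `k ≤ 1` this is the trivial family `0`, and the
  -- command emits a bit instead. In the loss, `2 * depth S + 2` pays for the choice of a heavy
  -- string, `s` for extending it to length `s`, and the final `1` for the later choice of a guess.
  ((bif b then 0 else S.headI.mode + 1, bif b then S.headI.mode - 1 else 0, 0),
    (s, 2 * depth S + 2 + s + 1, s))

/-- The output produced when the bit `b` is decoded. -/
def emitted (b : Bool) (k : ℕ) : List Bool :=
  if b = true ∧ k ≤ 1 then [decide (k = 1)] else []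

/-- The bit decoded at stage `ν.length`, if any. -/
def decoded (S : List Entry) (ν : List Bool) : Option Bool :=
  if (candidates T S ν).head? = some (ν.take (depth S + 1)) then some false
  else if (candidates T S ν).getLast? = some (ν.take (depth S + 1)) then some true
  else none

/-- One step of the decoding machine. -/
def step (st : List Entry × List Bool) (ν : List Bool) : List Entry × List Bool :=
  if (revise T st.1 ν).2 = true then ((revise T st.1 ν).1, st.2)
  else (decoded T st.1 ν).elim st fun b =>
    (newEntry b st.1 ν.length :: st.1, st.2 ++ emitted b st.1.headI.mode)

/-- The state of the decoding machine after reading a string. -/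
def run (σ : List Bool) : List Entry × List Bool :=
  (σ.foldl (fun p b => (p.1 ++ [b], step T p.2 (p.1 ++ [b])))
    (([] : List Bool), ([((0, 0, 0), (0, 0, 0))], []))).2

variable {T}

lemma run_concat (σ : List Bool) (b : Bool) :
    run T (σ ++ [b]) = step T (run T σ) (σ ++ [b]) := by
  have h (σ : List Bool) : (σ.foldl (fun p b => (p.1 ++ [b], step T p.2 (p.1 ++ [b])))
      (([] : List Bool), ([(((0, 0, 0), (0, 0, 0)) : Entry)], ([] : List Bool)))).1 = σ := by
    induction σ using List.reverseRecOn with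
    | nil => rfl
    | append_singleton l a ih => simp [ih]
  simp only [run, List.foldl_append, List.foldl_cons, List.foldl_nil, h]

lemma revise_cons (x : Entry) (S : List Entry) (ν : List Bool) :
    revise T (x :: S) ν = if (revise T S ν).2 = true then revise T S ν
      else if refuted T (x :: (revise T S ν).1) ν = true then
        (nextGuess x ν.length :: (revise T S ν).1, true)
      else (x :: (revise T S ν).1, false) := rfl

lemma revise_fst {S : List Entry} {ν : List Bool} (h : (revise T S ν).2 = false) :
    (revise T S ν).1 = S := by
  induction S with
  | nil => rfl
  | cons x S ih =>
    rw [revise_cons] at h ⊢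
    split_ifs at h ⊢ with h1
    · simp [h1] at h
    · simp [ih (by simpa using h1)]

lemma revise_append_of_true {S : List Entry} {ν : List Bool} (h : (revise T S ν).2 = true)
    (R : List Entry) : revise T (R ++ S) ν = revise T S ν := by
  induction R with
  | nil => rfl
  | cons x R ih => rw [List.cons_append, revise_cons, ih, if_pos h]

lemma revise_append_of_false {S : List Entry} {ν : List Bool} (h : (revise T S ν).2 = false)
    (R : List Entry) : ∃ R', (revise T (R ++ S) ν).1 = R' ++ S := by
  induction R with
  | nil => exact ⟨[], by simp [revise_fst h]⟩
  | cons x R ih =>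
    obtain ⟨R', hR'⟩ := ih
    rw [List.cons_append, revise_cons]
    split_ifs
    · exact ⟨R', hR'⟩
    · exact ⟨nextGuess x ν.length :: R', by simp [hR']⟩
    · exact ⟨x :: R', by simp [hR']⟩

lemma output_prefix_step (st : List Entry × List Bool) (ν : List Bool) :
    st.2 <+: (step T st ν).2 := by
  unfold step
  split_ifs
  · exact List.prefix_rfl
  · cases decoded T st.1 ν <;> simp

lemma output_prefix {σ τ : List Bool} (h : σ <+: τ) : (run T σ).2 <+: (run T τ).2 := by
  obtain ⟨u, rfl⟩ := h
  induction u using List.reverseRecOn with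
  | nil => simp
  | append_singleton l a ih =>
    rw [← List.append_assoc, run_concat]
    exact ih.trans (output_prefix_step _ _)

lemma step_append {S : List Entry} {ν : List Bool} (h : (revise T S ν).2 = false)
    (R : List Entry) (o : List Bool) : ∃ R', (step T (R ++ S, o) ν).1 = R' ++ S := by
  unfold step
  split_ifs
  · exact revise_append_of_false h R
  · cases hd : decoded T (R ++ S) ν with
    | none => exact ⟨R, by simp⟩
    | some b => exact ⟨newEntry b (R ++ S) ν.length :: R, by simp⟩

/-! ### True beliefs and the refutation of false ones -/

/-- All beliefs recorded in the stack are true along `ρ`. -/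
def Stable (T : ℕ → ℕ → List Bool → Bool) (ρ : List Bool) : List Entry → Prop
  | [] => True
  | x :: xs => x.base ≤ ρ.length ∧ (1 / 2 : ℝ) ^ x.loss ≤ mass T (x :: xs) (ρ.take x.base) ∧
      Stable T ρ xs

lemma take_of_prefix {σ τ : List Bool} (h : σ <+: τ) {i : ℕ} (hi : i ≤ σ.length) :
    τ.take i = σ.take i := by
  obtain ⟨u, rfl⟩ := h
  exact List.take_append_of_le_length hi

lemma Stable.extend {ρ ρ' : List Bool} {S : List Entry} (h : Stable T ρ S) (hp : ρ <+: ρ') :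
    Stable T ρ' S := by
  induction S with
  | nil => trivial
  | cons x S ih =>
    obtain ⟨h1, h2, h3⟩ := h
    exact ⟨h1.trans hp.length_le, by rwa [take_of_prefix hp h1], ih h3⟩

/-- Translates bounds on mass into the integer comparisons that the machine performs. -/
lemma half_pow_le_iff {a b c : ℕ} :
    (1 / 2 : ℝ) ^ c ≤ a * (1 / 2 : ℝ) ^ b ↔ 2 ^ b ≤ a * 2 ^ c := by
  have h : (2 ^ b ≤ a * 2 ^ c) ↔ ((2 : ℝ) ^ b ≤ a * 2 ^ c) := by
    constructor
    · intro h; exact_mod_cast h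
    · intro h; exact_mod_cast h
  rw [h, one_div, inv_pow, inv_pow, ← div_eq_mul_inv, le_div_iff₀ (by positivity),
    inv_mul_le_iff₀ (by positivity), mul_comm (a : ℝ)]

lemma refuted_cons_iff {x : Entry} {S : List Entry} {ν : List Bool} :
    refuted T (x :: S) ν = true ↔
      count T (x :: S) (ν.take x.base) ν.length * 2 ^ x.loss < 2 ^ ν.length :=
  decide_eq_true_iff

lemma not_refuted {x : Entry} {S : List Entry} {ν : List Bool}
    (h : (1 / 2 : ℝ) ^ x.loss ≤ mass T (x :: S) (ν.take x.base)) :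
    refuted T (x :: S) ν = false := by
  have h1 := h.trans (mass_le_count (s := ν.length) _ (by simp))
  rw [half_pow_le_iff] at h1
  rw [← Bool.not_eq_true, refuted_cons_iff, not_lt]
  exact h1

/-- Counts overestimate masses, so a true belief is never refuted. -/
lemma Stable.revise_eq {ν : List Bool} {S : List Entry} (h : Stable T ν S) :
    revise T S ν = (S, false) := by
  induction S with
  | nil => rfl
  | cons x S ih =>
    obtain ⟨h1, h2, h3⟩ := h
    rw [revise_cons, ih h3]
    simp [not_refuted h2]

lemma eventually_refuted (hT : TreeFamily T) {x : Entry} {S : List Entry} {ρ : List Bool}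
    (hb : x.base = ρ.length) (h : mass T (x :: S) ρ < (1 / 2 : ℝ) ^ x.loss) :
    ∀ᶠ s in Filter.atTop, ∀ ν, ρ <+: ν → ν.length = s → refuted T (x :: S) ν = true := by
  filter_upwards [eventually_count_lt hT h] with s hs ν hν hl
  have h1 : ν.take x.base = ρ := by rw [take_of_prefix hν hb.le, hb, List.take_length]
  rw [← not_le, half_pow_le_iff, not_le] at hs
  rwa [refuted_cons_iff, h1, hl]

/-- The test looks only at the part of the oracle below the base position and at the stage. Hence
refutation happens simultaneously along all extensions of `ρ`. -/
lemma refuted_congr {x : Entry} {S : List Entry} {ρ ν ν' : List Bool} (hb : x.base ≤ ρ.length)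
    (h : ρ <+: ν) (h' : ρ <+: ν') (hl : ν.length = ν'.length) :
    refuted T (x :: S) ν = refuted T (x :: S) ν' := by
  rw [Bool.eq_iff_iff, refuted_cons_iff, refuted_cons_iff, hl, take_of_prefix h hb,
    take_of_prefix h' hb]

lemma prefix_concat_cases {ρ ν : List Bool} (h : ρ <+: ν) :
    ν = ρ ∨ ∃ ν' b, ν = ν' ++ [b] ∧ ρ <+: ν' := by
  obtain ⟨u, rfl⟩ := h
  induction u using List.reverseRecOn with
  | nil => simp
  | append_singleton l a _ => exact Or.inr ⟨ρ ++ l, a, by simp, by simp⟩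

/-- As long as a stack is not revised, it stays at the bottom of the machine's stack. -/
lemma run_persist {ρ : List Bool} {W : List Entry} {l l' : ℕ} (hl : ρ.length ≤ l)
    (h0 : ∀ ν, ρ <+: ν → ν.length = l → (run T ν).1 = W)
    (hrev : ∀ ν, ρ <+: ν → l < ν.length → ν.length < l' → (revise T W ν).2 = false)
    (n : ℕ) : ∀ ν, ρ <+: ν → ν.length = l + n → l + n < l' → ∃ R, (run T ν).1 = R ++ W := by
  induction n with
  | zero => intro ν h1 h2 _; exact ⟨[], by simpa using h0 ν h1 (by simpa using h2)⟩
  | succ n ih =>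
    intro ν h1 h2 h3
    rcases prefix_concat_cases h1 with rfl | ⟨ν', b, rfl, h4⟩
    · omega
    · have h5 : ν'.length = l + n := by simp at h2; omega
      obtain ⟨R, hR⟩ := ih ν' h4 h5 (by omega)
      rw [run_concat]
      have := step_append (hrev (ν' ++ [b]) h1 (by omega) (by omega)) R (run T ν').2
      rwa [← hR] at this

/-- If the first `j` guesses of the top record are wrong, then the machine arrives at guess `j`
at a stage that does not depend on the sequence being read. -/
lemma exists_stage_guess (hT : TreeFamily T) {ρ : List Bool} {S : List Entry} (hS : Stable T ρ S)
    {k e c : ℕ} {o : List Bool} (h0 : run T ρ = (((k, e, 0), (ρ.length, c, ρ.length)) :: S, o))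
    (j : ℕ) (hj : ∀ i < j, mass T (((k, e, i), (ρ.length, c, ρ.length)) :: S) ρ < (1 / 2 : ℝ) ^ c) :
    ∃ l, ρ.length ≤ l ∧ ∀ ν, ρ <+: ν → ν.length = l →
      (run T ν).1 = ((k, e, j), (ρ.length, c, l)) :: S := by
  induction j with
  | zero =>
    refine ⟨ρ.length, le_rfl, fun ν h1 h2 => ?_⟩
    rw [← h1.eq_of_length h2.symm, h0]
  | succ j ih =>
    obtain ⟨l, hl, hrun⟩ := ih fun i hi => hj i (by omega)
    set x : Entry := ((k, e, j), (ρ.length, c, l)) with hx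
    have hm : mass T (x :: S) ρ < (1 / 2 : ℝ) ^ x.loss :=
      (mass_cons_guess rfl rfl).trans_lt (hj j (by omega))
    obtain ⟨N, hN⟩ := Filter.eventually_atTop.1 (eventually_refuted hT (x := x) rfl hm)
    -- At the least such stage the record `x` is revised for the first time. Whatever has been
    -- stacked above it meanwhile depends on the oracle, but is deleted.
    have hex : ∃ s, l < s ∧ ∀ ν, ρ <+: ν → ν.length = s → refuted T (x :: S) ν = true :=
      ⟨max N (l + 1), by omega, hN _ (le_max_left _ _)⟩
    classical
    obtain ⟨hs1, hs2⟩ := Nat.find_spec hex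
    have hmin := fun m => Nat.find_min hex (m := m)
    set s := Nat.find hex with hs
    have hrev : ∀ ν, ρ <+: ν → l < ν.length → ν.length < s →
        (revise T (x :: S) ν).2 = false := by
      intro ν h1 h2 h3
      have h4 := hmin _ h3
      push Not at h4
      obtain ⟨ν', h5, h6, h7⟩ := h4 h2
      rw [refuted_congr le_rfl h5 h1 h6] at h7
      rw [revise_cons, (hS.extend h1).revise_eq]
      simp [h7]
    refine ⟨s, by omega, fun ν h1 h2 => ?_⟩
    rcases prefix_concat_cases h1 with rfl | ⟨ν', b, rfl, h4⟩
    · omega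
    · have h5 : ν'.length = l + (s - 1 - l) := by simp at h2; omega
      obtain ⟨R, hR⟩ := run_persist hl hrun hrev (s - 1 - l) ν' h4 h5 (by omega)
      have h6 : revise T (x :: S) (ν' ++ [b]) = (nextGuess x s :: S, true) := by
        rw [revise_cons, (hS.extend h1).revise_eq]
        simp only [Bool.false_eq_true, if_false]
        rw [if_pos (hs2 _ h1 h2), h2]
      rw [run_concat, step, hR, revise_append_of_true (by rw [h6]), h6]
      rfl

/-! ### Coding a digit above a good string -/

lemma exists_first_last {L : List (List Bool)} {p : List Bool → Bool}
    (h : ∃ a ∈ L, ∃ b ∈ L, a ≠ b ∧ p a = true ∧ p b = true) (hL : L.Nodup) :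
    ∃ a b, (L.filter p).head? = some a ∧ (L.filter p).getLast? = some b ∧ a ≠ b := by
  obtain ⟨a, ha, b, hb, hab, hpa, hpb⟩ := h
  have ha' : a ∈ L.filter p := List.mem_filter.2 ⟨ha, hpa⟩
  have hb' : b ∈ L.filter p := List.mem_filter.2 ⟨hb, hpb⟩
  have hn : (L.filter p).Nodup := hL.filter p
  generalize L.filter p = M at ha' hb' hn
  match M, ha', hb', hn with
  | [c], ha', hb', _ => simp at ha' hb'; exact absurd (ha'.trans hb'.symm) hab
  | c :: d :: M, _, _, hn =>
    refine ⟨c, (d :: M).getLast (by simp), rfl, ?_, ?_⟩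
    · rw [List.getLast?_cons_cons, List.getLast?_eq_getLast_of_ne_nil]
    · intro h
      rw [List.nodup_cons] at hn
      exact hn.1 (h ▸ List.getLast_mem _)

lemma head?_filter_of_head? {M : List (List Bool)} {p : List Bool → Bool} {a : List Bool}
    (h : M.head? = some a) (hp : p a = true) : (M.filter p).head? = some a := by
  obtain ⟨M', rfl⟩ := List.head?_eq_some_iff.1 h
  simp [hp]

lemma getLast?_filter_of_getLast? {M : List (List Bool)} {p : List Bool → Bool} {a : List Bool}
    (h : M.getLast? = some a) (hp : p a = true) : (M.filter p).getLast? = some a := by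
  obtain ⟨M', rfl⟩ := List.getLast?_eq_some_iff.1 h
  simp [hp]

/-- The machine is about to decode a bit at `ρ`, and all its beliefs are true. -/
structure Good (T : ℕ → ℕ → List Bool → Bool) (ρ : List Bool) (S : List Entry) (o : List Bool) :
    Prop where
  run_eq : run T ρ = (S, o)
  stable : Stable T ρ S
  start_eq : S.headI.start = ρ.length
  le_mass : (1 / 2 : ℝ) ^ depth S ≤ mass T S ρ

lemma candidates_eq {S : List Entry} {ρ ν : List Bool} (hst : S.headI.start = ρ.length)
    (h : ρ <+: ν) : candidates T S ν = (extensions ρ (depth S + 1)).filter fun μ =>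
      decide (2 ^ ν.length ≤ count T S μ ν.length * 2 ^ (2 * depth S + 2)) := by
  rw [candidates, hst, take_of_prefix h le_rfl, List.take_length]

/-- Every bit can be coded above a good string. -/
lemma Good.exists_decoded (hT : TreeFamily T) {ρ : List Bool} {S : List Entry} {o : List Bool}
    (h : Good T ρ S o) (b : Bool) :
    ∃ ρ', ρ <+: ρ' ∧ ρ.length < ρ'.length ∧
      run T ρ' = (newEntry b S ρ'.length :: S, o ++ emitted b S.headI.mode) ∧
      (1 / 2 : ℝ) ^ (2 * depth S + 2 + ρ'.length) ≤ mass T S ρ' := by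
  classical
  set d := depth S with hd
  have hρd : ρ.length ≤ d := by rw [hd, depth, h.start_eq]; omega
  set E := extensions ρ (d + 1) with hE
  let p : List Bool → Bool := fun μ => decide ((1 / 2 : ℝ) ^ (2 * d + 2) ≤ mass T S μ)
  let C : ℕ → List (List Bool) := fun s => E.filter fun μ =>
    decide (2 ^ s ≤ count T S μ s * 2 ^ (2 * d + 2))
  have hnd : E.Nodup := (nodup_strings _).filter _
  obtain ⟨μ₀, μ₁, hfirst, hlast, hne⟩ : ∃ a b, (E.filter p).head? = some a ∧
      (E.filter p).getLast? = some b ∧ a ≠ b := by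
    refine exists_first_last ?_ hnd
    obtain ⟨ν, h1, ν', h2, h3, h4, h5⟩ := exists_two_extensions (by omega) h.le_mass
    exact ⟨ν, h1, ν', h2, h3, by simpa [p] using h4, by simpa [p] using h5⟩
  -- Truly heavy strings survive in the candidate list at every stage; the other strings eventually
  -- leave it, which is `hevent`.
  have hC (s : ℕ) (hs : d + 1 ≤ s) : (C s).filter p = E.filter p := by
    rw [List.filter_filter]
    refine List.filter_congr fun μ hμ => ?_
    have hlen := (mem_extensions.1 hμ).1
    by_cases hp : p μ = true
    · have h1 : (1 / 2 : ℝ) ^ (2 * d + 2) ≤ mass T S μ := by simpa [p] using hp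
      have h2 := h1.trans (mass_le_count (s := s) _ (by omega))
      rw [half_pow_le_iff] at h2
      simp [hp, h2]
    · simp [hp]
  have hevent : ∀ᶠ s in Filter.atTop, C s = E.filter p := by
    have h1 : ∀ μ ∈ E.toFinset, ∀ᶠ s in Filter.atTop,
        (decide (2 ^ s ≤ count T S μ s * 2 ^ (2 * d + 2)) = true → p μ = true) := by
      intro μ _
      by_cases hp : p μ = true
      · simp [hp]
      · have h2 : mass T S μ < (1 / 2 : ℝ) ^ (2 * d + 2) := by simpa [p] using hp
        filter_upwards [eventually_count_lt hT h2] with s hs hs'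
        exact absurd (half_pow_le_iff.2 (of_decide_eq_true hs')) (not_le.2 hs)
    filter_upwards [(Filter.eventually_all_finset _).2 h1, Filter.eventually_ge_atTop (d + 1)]
      with s hs hs'
    rw [← hC s hs', List.filter_filter]
    refine List.filter_congr fun μ hμ => ?_
    have := hs μ (by simpa using hμ)
    by_cases hp : decide (2 ^ s ≤ count T S μ s * 2 ^ (2 * d + 2)) = true
    · rw [hp, this hp]; rfl
    · rw [Bool.not_eq_true] at hp
      rw [hp, Bool.and_false]
  let target : List Bool := bif b then μ₁ else μ₀
  let test : ℕ → Prop := fun s =>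
    bif b then (C s).getLast? = some target else (C s).head? = some target
  have htarget : target ∈ E.filter p := by
    cases b
    · exact List.mem_of_mem_head? (by simpa [target] using hfirst)
    · exact List.mem_of_getLast? (by simpa [target] using hlast)
  obtain ⟨htE, htp⟩ := List.mem_filter.1 htarget
  obtain ⟨htl, htρ⟩ := mem_extensions.1 htE
  have hex : ∃ s, d + 1 ≤ s ∧ test s := by
    obtain ⟨s, hs, hs'⟩ := (hevent.and (Filter.eventually_ge_atTop (d + 1))).exists
    refine ⟨s, hs', ?_⟩
    cases b
    · simpa [test, hs, target] using hfirst
    · simpa [test, hs, target] using hlast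
  obtain ⟨hs1, hs2⟩ := Nat.find_spec hex
  have hmin := fun m => Nat.find_min hex (m := m)
  set s := Nat.find hex with hs
  have hcandidates (ν : List Bool) (hν : ρ <+: ν) : candidates T S ν = C ν.length :=
    candidates_eq h.start_eq hν
  -- The target is extended to length exactly `s`, the first stage at which it is recognised, so
  -- that decoding occurs just when `ρ'` has been read.
  obtain ⟨ρ', hρ', hlen, hmass⟩ := exists_extension_mass (T := T) (S := S) (c := 2 * d + 2)
    (l := s) (htl.trans_le hs1) (by simpa [p] using htp)
  have htake {ν : List Bool} (hν : ν <+: ρ') (hl : d + 1 ≤ ν.length) :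
      ν.take (d + 1) = target := by
    rw [← htl] at hl ⊢
    rw [← take_of_prefix hν hl, take_of_prefix hρ' le_rfl, List.take_length]
  -- Before stage `s` the right digit is excluded by minimality. The wrong digit is excluded because
  -- the heavy string at the other end is always a candidate, so the target cannot be at that end.
  -- Below length `d + 1` nothing matches.
  have hnone (ν : List Bool) (h1 : ρ <+: ν) (h2 : ν <+: ρ') (h3 : ν.length < s) :
      decoded T S ν = none := by
    rw [decoded, hcandidates ν h1, ← hd]
    by_cases hl : d + 1 ≤ ν.length
    · rw [htake h2 hl]
      have h4 : ¬ test ν.length := fun h => hmin _ h3 ⟨hl, h⟩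
      rw [if_neg, if_neg]
      · cases b
        · intro h5
          have := getLast?_filter_of_getLast? h5 htp
          rw [hC _ hl, hlast] at this
          exact hne (Option.some.inj this).symm
        · simpa [test] using h4
      · cases b
        · simpa [test] using h4
        · intro h5
          have := head?_filter_of_head? h5 htp
          rw [hC _ hl, hfirst] at this
          exact hne (Option.some.inj this)
    · have hmem (hM : ν.take (d + 1) ∈ C ν.length) : False := by
        have := (mem_extensions.1 (List.mem_filter.1 hM).1).1
        simp at this
        omega
      rw [if_neg, if_neg]
      · exact fun h5 => hmem (List.mem_of_getLast? h5)
      · exact fun h5 => hmem (List.mem_of_mem_head? h5)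
  have hsome : decoded T S ρ' = some b := by
    rw [decoded, hcandidates ρ' (htρ.trans hρ'), ← hd, htake List.prefix_rfl (hlen ▸ hs1), hlen]
    cases b
    · rw [if_pos (by simpa [test] using hs2)]
    · rw [if_neg, if_pos (by simpa [test] using hs2)]
      intro h5
      have := head?_filter_of_head? h5 htp
      rw [hC _ hs1, hfirst] at this
      exact hne (Option.some.inj this)
  have hstay (n : ℕ) : ∀ ν, ρ <+: ν → ν <+: ρ' → ν.length = ρ.length + n → ν.length < s →
      run T ν = (S, o) := by
    induction n with
    | zero => intro ν h1 _ h3 _; rw [← h1.eq_of_length h3.symm, h.run_eq]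
    | succ n ih =>
      intro ν h1 h2 h3 h4
      rcases prefix_concat_cases h1 with rfl | ⟨ν', b, rfl, h5⟩
      · omega
      · have h6 : ν' <+: ρ' := (List.prefix_append _ _).trans h2
        rw [List.length_append, List.length_singleton] at h3 h4
        rw [run_concat, ih ν' h5 h6 (by omega) (by omega), step,
          (h.stable.extend h1).revise_eq, hnone _ h1 h2 (by simpa using h4)]
        simp
  refine ⟨ρ', htρ.trans hρ', by omega, ?_, by rw [hlen]; exact hmass⟩
  rcases prefix_concat_cases (htρ.trans hρ') with h1 | ⟨ν', b', h1, h5⟩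
  · rw [h1] at hlen; omega
  · have h6 : ν' <+: ρ' := by rw [h1]; exact List.prefix_append _ _
    have h7 : ν'.length + 1 = s := by rw [← hlen, h1]; simp
    have h8 := hstay (ν'.length - ρ.length) ν' h5 h6
      (by have := h5.length_le; omega) (by omega)
    have h9 : run T ρ' = step T (S, o) ρ' := by
      rw [← h8, h1, run_concat]
    rw [h9, step, (h.stable.extend (htρ.trans hρ')).revise_eq, hsome]
    simp

/-- After decoding a bit that calls for a null requirement, a good string can be reached. -/
lemma Good.exists_good (hT : TreeFamily T) {ρ : List Bool} {S : List Entry} {o : List Bool}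
    (h : Good T ρ S o) (b : Bool)
    (he : NullIndex T (newEntry b S 0).req) :
    ∃ ρ' y o', ρ <+: ρ' ∧ ρ.length < ρ'.length ∧
      Good T ρ' (y :: S) (o ++ emitted b S.headI.mode ++ o') ∧
      y.mode = (newEntry b S 0).mode ∧ y.req = (newEntry b S 0).req ∧
      ((newEntry b S 0).req = 0 → o' = []) := by
  classical
  obtain ⟨τ, h1, h2, h3, h4⟩ := h.exists_decoded hT b
  set x := newEntry b S τ.length with hx
  -- Strict thanks to the extra `1` in the loss of the new record.
  have hlt : (1 / 2 : ℝ) ^ x.loss < mass T S τ := by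
    refine lt_of_lt_of_le (pow_lt_pow_right_of_lt_one₀ (by norm_num) (by norm_num) ?_) h4
    simp [hx, newEntry]
  have hex : ∃ n, (1 / 2 : ℝ) ^ x.loss <
      mass T (((x.mode, x.req, n), (τ.length, x.loss, τ.length)) :: S) τ :=
    exists_guess hT he hlt _ _ _ _
  have hex' : ∃ n, (1 / 2 : ℝ) ^ x.loss ≤
      mass T (((x.mode, x.req, n), (τ.length, x.loss, τ.length)) :: S) τ :=
    hex.imp fun _ => le_of_lt
  have hspec := Nat.find_spec hex'
  have hmin := fun m => Nat.find_min hex' (m := m)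
  set n := Nat.find hex' with hn
  obtain ⟨l, hl, hrun⟩ := exists_stage_guess hT (h.stable.extend h1) (k := x.mode) (e := x.req)
    (c := x.loss) (o := o ++ emitted b S.headI.mode) h3 n fun i hi => not_le.1 (hmin i hi)
  have hn0 (h0 : x.req = 0) : n = 0 := by
    rw [hn, Nat.find_eq_zero]
    exact hlt.le.trans (mass_cons_zero hT _ _ _ h0).ge
  -- When the first guess is right no waiting is needed. Staying at `τ` then guarantees that no junk
  -- is output, in particular for family `0`.
  set l' := if n = 0 then τ.length else l with hl'
  have hll' : τ.length ≤ l' := by rw [hl']; split_ifs <;> omega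
  have hrun' : ∀ ν, τ <+: ν → ν.length = l' →
      (run T ν).1 = ((x.mode, x.req, n), (τ.length, x.loss, l')) :: S := by
    intro ν h5 h6
    by_cases h0 : n = 0
    · rw [hl', if_pos h0] at h6 ⊢
      rw [← h5.eq_of_length h6.symm, h3, h0]
      rfl
    · rw [hl', if_neg h0] at h6 ⊢
      exact hrun ν h5 h6
  set y : Entry := ((x.mode, x.req, n), (τ.length, x.loss, l')) with hy
  have hspec' : (1 / 2 : ℝ) ^ x.loss ≤ mass T (y :: S) τ :=
    hspec.trans (mass_cons_guess rfl rfl).le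
  obtain ⟨ρ', h5, h6, h7⟩ := exists_extension_mass hll' hspec'
  -- `o'` is whatever the machine output while working with wrong guesses.
  obtain ⟨o', ho'⟩ := output_prefix (T := T) h5
  rw [h3] at ho'
  refine ⟨ρ', y, o', h1.trans h5, h2.trans_le h5.length_le, ⟨?_, ?_, ?_, ?_⟩, rfl, rfl, ?_⟩
  · exact Prod.ext (hrun' ρ' h5 h6) ho'.symm
  · refine ⟨h5.length_le, ?_, h.stable.extend (h1.trans h5)⟩
    rw [take_of_prefix h5 le_rfl, List.take_length]
    exact hspec'
  · simp [hy, h6]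
  · exact h7
  · intro h0
    have : l' = τ.length := by rw [hl', if_pos (hn0 h0)]
    rw [← h5.eq_of_length (by rw [h6, this]), h3] at ho'
    simpa using ho'

lemma good_nil (hT : TreeFamily T) : Good T [] [((0, 0, 0), (0, 0, 0))] [] := by
  have hm : (1 : ℝ) ≤ mass T [((0, 0, 0), (0, 0, 0))] [] := by
    rw [mass_cons_zero hT _ _ _ rfl]
    have := uniformMeasure_basicOpen []
    simp only [mass, alive, List.all_nil, implies_true, Set.ofPred_true, Set.univ_inter, this]
    simp
  exact ⟨rfl, ⟨le_rfl, (pow_zero _).trans_le hm, trivial⟩, rfl, (pow_zero _).trans_le hm⟩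

/-! ### Dense open sets and limits of chains of strings -/

lemma isOpen_basicOpen (σ : List Bool) : IsOpen (basicOpen σ) := by
  rw [basicOpen_eq_pi]
  exact isOpen_set_pi (Finset.finite_toSet _) fun i _ => isOpen_discrete _

lemma exists_basicOpen_subset {U : Set Cantor} (hU : IsOpen U) {Z : Cantor} (hZ : Z ∈ U) :
    ∃ m, basicOpen (seg Z m) ⊆ U := by
  obtain ⟨I, u, hu, hsub⟩ := isOpen_pi_iff.1 hU Z hZ
  refine ⟨I.sup id + 1, fun W hW => hsub fun i hi => ?_⟩
  have hi' : i < I.sup id + 1 := Nat.lt_succ_of_le (Finset.le_sup (f := id) hi)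
  have := hW ⟨i, by simpa using hi'⟩
  rw [List.get_eq_getElem, getElem_seg] at this
  have h2 : W i = Z i := this
  rw [h2]
  exact (hu i hi).2

lemma basicOpen_nonempty (σ : List Bool) : (basicOpen σ).Nonempty :=
  ⟨fun i => σ.getD i false, fun i => by simp⟩

lemma exists_append_basicOpen_subset {U : Set Cantor} (hU : IsOpen U) (hd : Dense U)
    (σ : List Bool) : ∃ τ, τ ≠ [] ∧ basicOpen (σ ++ τ) ⊆ U := by
  obtain ⟨Z, hZσ, hZ⟩ := hd.inter_open_nonempty _ (isOpen_basicOpen σ) (basicOpen_nonempty σ)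
  obtain ⟨m, hm⟩ := exists_basicOpen_subset hU hZ
  set l := max m (σ.length + 1) with hl
  have hlσ : σ.length + 1 ≤ l := le_max_right _ _
  obtain ⟨τ, hτ⟩ := (mem_basicOpen_iff_prefix (by omega : σ.length ≤ l)).1 hZσ
  refine ⟨τ, ?_, ?_⟩
  · rintro rfl
    have := congrArg List.length hτ
    simp at this
    omega
  · rw [hτ]
    exact (basicOpen_anti (seg_prefix_seg Z (le_max_left _ _))).trans hm

lemma prefix_of_le {ρ : ℕ → List Bool} (hp : ∀ n, ρ n <+: ρ (n + 1)) {m n : ℕ} (h : m ≤ n) :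
    ρ m <+: ρ n := by
  induction n, h using Nat.le_induction with
  | base => exact List.prefix_rfl
  | succ n _ ih => exact ih.trans (hp n)

lemma le_length_of_chain {ρ : ℕ → List Bool} (hl : ∀ n, (ρ n).length < (ρ (n + 1)).length)
    (n : ℕ) : n ≤ (ρ n).length := by
  induction n with
  | zero => simp
  | succ n ih => exact Nat.succ_le_of_lt (ih.trans_lt (hl n))

/-- A strictly increasing chain of strings has a limit sequence. -/
lemma exists_limit {ρ : ℕ → List Bool} (hp : ∀ n, ρ n <+: ρ (n + 1))
    (hl : ∀ n, (ρ n).length < (ρ (n + 1)).length) : ∃ X : Cantor, ∀ n, seg X (ρ n).length = ρ n := by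
  -- `ρ (i + 1)` has length at least `i + 1`, so the default value is never used.
  refine ⟨fun i => (ρ (i + 1)).getD i false, fun n => ?_⟩
  apply List.ext_getElem (by simp)
  intro i h1 h2
  have h3 : i < (ρ (i + 1)).length := le_length_of_chain hl (i + 1)
  rw [getElem_seg, List.getD_eq_getElem _ _ h3]
  rcases le_total n (i + 1) with h | h
  · exact ((prefix_of_le hp h).getElem h2).symm
  · exact (prefix_of_le hp h).getElem h3


/-! ### Issuing commands and building the sequence -/

lemma nullIndex_zero (hT : TreeFamily T) : NullIndex T 0 := by
  simp [NullIndex, hT.zero]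

/-- A good string whose machine has just finished decoding a command. -/
structure Ready (T : ℕ → ℕ → List Bool → Bool) (ρ : List Bool) (S : List Entry) (o : List Bool) :
    Prop extends Good T ρ S o where
  mode_eq : S.headI.mode = 0

lemma Good.exists_zeros (hT : TreeFamily T) {ρ : List Bool} {S : List Entry} {o : List Bool}
    (h : Good T ρ S o) (k : ℕ) :
    ∃ ρ' R, ρ <+: ρ' ∧ Good T ρ' (R ++ S) o ∧ (R ++ S).headI.mode = S.headI.mode + k := by
  induction k with
  | zero => exact ⟨ρ, [], List.prefix_rfl, h, rfl⟩
  | succ k ih =>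
    obtain ⟨ρ', R, h1, h2, h3⟩ := ih
    obtain ⟨ρ'', y, o', h4, -, h5, h6, -, h8⟩ := h2.exists_good hT false (nullIndex_zero hT)
    obtain rfl := h8 rfl
    refine ⟨ρ'', y :: R, h1.trans h4, by simpa [emitted] using h5, ?_⟩
    exact h6.trans (congrArg (· + 1) h3)

/-- The command is `1` for the bit `false` and `01` for `true`. Both use only the trivial family, so
the output is exactly the intended bit. -/
lemma Ready.exists_bit (hT : TreeFamily T) {ρ : List Bool} {S : List Entry} {o : List Bool}
    (h : Ready T ρ S o) (b : Bool) :
    ∃ ρ' R, ρ <+: ρ' ∧ Ready T ρ' (R ++ S) (o ++ [b]) := by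
  obtain ⟨ρ', R, h1, h2, h3⟩ := h.toGood.exists_zeros hT b.toNat
  rw [h.mode_eq, zero_add] at h3
  have hreq : (newEntry true (R ++ S) 0).req = 0 := by
    change (R ++ S).headI.mode - 1 = 0
    rw [h3]; cases b <;> rfl
  obtain ⟨ρ'', y, o', h4, -, h5, h6, -, h8⟩ := h2.exists_good hT true (hreq ▸ nullIndex_zero hT)
  obtain rfl := h8 hreq
  refine ⟨ρ'', y :: R, h1.trans h4, ⟨?_, h6⟩⟩
  rw [h3] at h5
  cases b <;> simpa [emitted] using h5

lemma Ready.exists_bits (hT : TreeFamily T) {ρ : List Bool} {S : List Entry} {o : List Bool}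
    (h : Ready T ρ S o) (u : List Bool) :
    ∃ ρ' R, ρ <+: ρ' ∧ Ready T ρ' (R ++ S) (o ++ u) := by
  induction u using List.reverseRecOn with
  | nil => exact ⟨ρ, [], List.prefix_rfl, by simpa using h⟩
  | append_singleton l a ih =>
    obtain ⟨ρ', R, h1, h2⟩ := ih
    obtain ⟨ρ'', R', h3, h4⟩ := h2.exists_bit hT a
    exact ⟨ρ'', R' ++ R, h1.trans h3, by simpa using h4⟩

/-- The command is `e + 2` zeros followed by a one; commands with fewer than two zeros are reserved
for bits. The output `o'` is uncontrolled. -/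
lemma Ready.exists_requirement (hT : TreeFamily T) {ρ : List Bool} {S : List Entry}
    {o : List Bool} (h : Ready T ρ S o) {e : ℕ} (he : NullIndex T (e + 1)) :
    ∃ ρ' R o', ρ <+: ρ' ∧ ρ.length < ρ'.length ∧ Ready T ρ' (R ++ S) (o ++ o') ∧
      ∃ y ∈ R, y.req = e + 1 := by
  obtain ⟨ρ', R, h1, h2, h3⟩ := h.toGood.exists_zeros hT (e + 2)
  rw [h.mode_eq, zero_add] at h3
  have hreq : (newEntry true (R ++ S) 0).req = e + 1 := by
    change (R ++ S).headI.mode - 1 = e + 1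
    rw [h3]; rfl
  obtain ⟨ρ'', y, o', h4, h9, h5, h6, h7, -⟩ := h2.exists_good hT true (hreq ▸ he)
  refine ⟨ρ'', y :: R, emitted true (R ++ S).headI.mode ++ o', h1.trans h4,
    h1.length_le.trans_lt h9, ⟨by simpa using h5, h6⟩, y, by simp, h7.trans hreq⟩

/-- The output is steered into `U` before the requirement is called, so junk appended afterwards
stays inside the cylinder already secured. -/
lemma Ready.exists_next (hT : TreeFamily T) {ρ : List Bool} {S : List Entry}
    {o : List Bool} (h : Ready T ρ S o) {U : Set Cantor} (hU : IsOpen U) (hd : Dense U) (e : ℕ) :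
    ∃ ρ' R o', ρ <+: ρ' ∧ ρ.length < ρ'.length ∧ Ready T ρ' (R ++ S) (o ++ o') ∧ o' ≠ [] ∧
      basicOpen (o ++ o') ⊆ U ∧ (NullIndex T (e + 1) → ∃ y ∈ R, y.req = e + 1) := by
  obtain ⟨u, hu, hsub⟩ := exists_append_basicOpen_subset hU hd o
  obtain ⟨ρ₁, R₁, h1, h2⟩ := h.exists_bits hT u
  by_cases he : NullIndex T (e + 1)
  · obtain ⟨ρ₂, R₂, o₂, h3, h4, h5, y, hy, hy'⟩ := h2.exists_requirement hT he
    refine ⟨ρ₂, R₂ ++ R₁, u ++ o₂, h1.trans h3, h1.length_le.trans_lt h4, by simpa using h5,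
      by simp [hu], ?_, fun _ => ⟨y, by simp [hy], hy'⟩⟩
    rw [← List.append_assoc]
    exact (basicOpen_anti (List.prefix_append _ _)).trans hsub
  · obtain ⟨ρ₂, y, o₂, h3, h4, h5, h6, -, h7⟩ := h2.toGood.exists_good hT true
      (by rw [show (newEntry true (R₁ ++ S) 0).req = 0 from by
            change (R₁ ++ S).headI.mode - 1 = 0
            rw [h2.mode_eq]]
          exact nullIndex_zero hT)
    refine ⟨ρ₂, y :: R₁, u ++ (emitted true (R₁ ++ S).headI.mode ++ o₂), h1.trans h3,
      h1.length_le.trans_lt h4, ⟨by simpa using h5, h6⟩, by simp [hu], ?_, fun h => absurd h he⟩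
    rw [← List.append_assoc]
    exact (basicOpen_anti (List.prefix_append _ _)).trans hsub

/-- There is a sequence that is trapped in a tree of every null family of trees, and on which the
machine produces a sequence belonging to the given dense open sets. -/
theorem exists_trapped_generic (hT : TreeFamily T) {U : ℕ → Set Cantor} (hU : ∀ n, IsOpen (U n))
    (hd : ∀ n, Dense (U n)) :
    ∃ X Y : Cantor, (∀ e, NullIndex T (e + 1) → ∃ n, ∀ s, T (e + 1) n (seg X s) = true) ∧
      (∀ n, Y ∈ U n) ∧
      (∀ s, (run T (seg X s)).2 <+: seg Y (run T (seg X s)).2.length) ∧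
      ∀ n, ∃ s, n < (run T (seg X s)).2.length := by
  let A := {p : List Bool × List Entry × List Bool // Ready T p.1 p.2.1 p.2.2}
  have hnext (p : A) (n : ℕ) : ∃ q : A, p.1.1 <+: q.1.1 ∧ p.1.1.length < q.1.1.length ∧
      p.1.2.1 <:+ q.1.2.1 ∧ p.1.2.2 <+: q.1.2.2 ∧ p.1.2.2.length < q.1.2.2.length ∧
      basicOpen q.1.2.2 ⊆ U n ∧ (NullIndex T (n + 1) → ∃ y ∈ q.1.2.1, y.req = n + 1) := by
    obtain ⟨ρ', R, o', h1, h2, h3, h4, h5, h6⟩ := p.2.exists_next hT (hU n) (hd n) n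
    refine ⟨⟨(ρ', R ++ p.1.2.1, p.1.2.2 ++ o'), h3⟩, h1, h2, List.suffix_append _ _,
      List.prefix_append _ _, ?_, h5, fun he => ?_⟩
    · have := List.length_pos_iff.2 h4
      simp [this]
    · obtain ⟨y, hy, hy'⟩ := h6 he
      exact ⟨y, List.mem_append_left _ hy, hy'⟩
  choose next hn1 hn2 hn3 hn4 hn5 hn6 hn7 using hnext
  let start : A := ⟨([], [((0, 0, 0), (0, 0, 0))], []), ⟨good_nil hT, rfl⟩⟩
  let q : ℕ → A := fun n => Nat.rec start (fun n p => next p n) n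
  have hq (n : ℕ) : q (n + 1) = next (q n) n := rfl
  obtain ⟨X, hX⟩ := exists_limit (ρ := fun n => (q n).1.1) (fun n => by rw [hq]; exact hn1 _ _)
    fun n => by rw [hq]; exact hn2 _ _
  obtain ⟨Y, hY⟩ := exists_limit (ρ := fun n => (q n).1.2.2) (fun n => by rw [hq]; exact hn4 _ _)
    fun n => by rw [hq]; exact hn5 _ _
  have hXlen (n : ℕ) : n ≤ (q n).1.1.length :=
    le_length_of_chain (ρ := fun n => (q n).1.1) (fun n => by rw [hq]; exact hn2 _ _) n
  have hYlen (n : ℕ) : n ≤ (q n).1.2.2.length :=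
    le_length_of_chain (ρ := fun n => (q n).1.2.2) (fun n => by rw [hq]; exact hn5 _ _) n
  have hrun (n : ℕ) : (run T (seg X (q n).1.1.length)).2 = seg Y (q n).1.2.2.length := by
    rw [hX, hY, (q n).2.run_eq]
  refine ⟨X, Y, fun e he => ?_, fun n => ?_, fun s => ?_, fun n => ?_⟩
  · obtain ⟨y, hy, hy'⟩ := hn7 (q e) e he
    refine ⟨y.guess, fun s => ?_⟩
    -- The record `y` is never removed along the construction, and positive mass keeps each string
    -- on all trees in use, so its guess is a tree containing every initial segment of `X`.
    have hsuf : ∀ m, e + 1 ≤ m → y ∈ (q m).1.2.1 := by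
      intro m hm
      induction m, hm using Nat.le_induction with
      | base => exact hy
      | succ m _ ih => exact (hn3 (q m) m).subset ih
    set m := max (e + 1) s with hm
    have hal : alive T (q m).1.2.1 (q m).1.1 = true :=
      alive_of_mass_pos (lt_of_lt_of_le (by positivity) (q m).2.le_mass)
    rw [alive, List.all_eq_true] at hal
    have h1 := hal y (hsuf m (le_max_left _ _))
    rw [hy'] at h1
    refine hT.closed _ _ _ _ ?_ h1
    rw [← hX m]
    exact seg_prefix_seg X ((le_max_right _ _).trans (hXlen m))
  · refine hn6 (q n) n ?_
    rw [mem_basicOpen_iff]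
    exact hY (n + 1)
  · have h1 := output_prefix (T := T) (seg_prefix_seg X (hXlen s))
    rw [hrun] at h1
    have h2 : (run T (seg X s)).2.length ≤ (q s).1.2.2.length := by
      simpa using h1.length_le
    rw [List.prefix_iff_eq_take, take_seg Y h2] at h1
    rw [← h1]
  · refine ⟨(q (n + 1)).1.1.length, ?_⟩
    refine lt_of_lt_of_eq ?_ (congrArg List.length (hrun (n + 1))).symm
    rw [length_seg]
    exact hYlen (n + 1)

/-! ### Turing reductions from computable monotone maps -/

section Oracle

variable {O : Set (ℕ →. ℕ)}

lemma recursiveIn_comp {f g : ℕ → ℕ} (hf : Nat.RecursiveIn O fun n => Part.some (f n))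
    (hg : Nat.RecursiveIn O fun n => Part.some (g n)) :
    Nat.RecursiveIn O fun n => Part.some (f (g n)) :=
  (Nat.RecursiveIn.comp hf hg).of_eq fun n => by simp

lemma recursiveIn_pair {f g : ℕ → ℕ} (hf : Nat.RecursiveIn O fun n => Part.some (f n))
    (hg : Nat.RecursiveIn O fun n => Part.some (g n)) :
    Nat.RecursiveIn O fun n => Part.some (Nat.pair (f n) (g n)) :=
  (Nat.RecursiveIn.pair hf hg).of_eq fun n => by simp [Seq.seq]

lemma recursiveIn_of_computable {f : ℕ → ℕ} (hf : Computable f) :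
    Nat.RecursiveIn O fun n => Part.some (f n) :=
  Nat.Partrec.recursiveIn (Partrec.nat_iff.1 hf)

lemma recursiveIn_seg (X : Cantor) :
    Nat.RecursiveIn {charFun X} fun s => Part.some (Encodable.encode (seg X s)) := by
  let H : ℕ → ℕ := fun n => Encodable.encode
    (((Encodable.decode (α := List Bool) n.unpair.1).getD []) ++ [decide (n.unpair.2 = 1)])
  have hH : Computable H := by
    apply Primrec.to_comp
    refine Primrec.encode.comp (Primrec.list_append.comp ?_ ?_)
    · exact Primrec.option_getD.comp
        (Primrec.decode.comp (Primrec.fst.comp Primrec.unpair)) (Primrec.const [])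
    · refine Primrec.list_cons.comp ?_ (Primrec.const [])
      exact (Primrec.eq.comp (Primrec.snd.comp Primrec.unpair) (Primrec.const 1)).decide
  have h1 : Nat.RecursiveIn {charFun X} fun n => Part.some (X n).toNat :=
    Nat.RecursiveIn.oracle _ rfl
  have hl : Nat.RecursiveIn {charFun X} fun n => Part.some n.unpair.1 :=
    recursiveIn_of_computable (Primrec.fst.comp Primrec.unpair).to_comp
  have hr : Nat.RecursiveIn {charFun X} fun n => Part.some n.unpair.2 :=
    recursiveIn_of_computable (Primrec.snd.comp Primrec.unpair).to_comp
  have h2 := recursiveIn_comp (recursiveIn_of_computable (O := {charFun X}) hH)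
    (recursiveIn_pair (recursiveIn_comp hr hr) (recursiveIn_comp h1 (recursiveIn_comp hl hr)))
  have h3 := Nat.RecursiveIn.prec
    (recursiveIn_of_computable (O := {charFun X}) (Computable.const (Encodable.encode ([] : List Bool))))
    h2
  have h4 := Nat.RecursiveIn.comp h3
    (recursiveIn_pair (recursiveIn_of_computable (O := {charFun X}) (Computable.const 0))
      (recursiveIn_of_computable Computable.id))
  refine h4.of_eq fun s => ?_
  simp only [id, Part.bind_eq_bind, Part.bind_some, Nat.unpair_pair]
  induction s with
  | zero => simp [seg]
  | succ s ih =>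
    refine (congrArg (fun p : Part ℕ =>
      p.bind fun i => Part.some (H (Nat.pair i (X s).toNat))) ih).trans ?_
    rw [seg_succ]
    cases X s <;> simp [H]

/-- A computable monotone map on strings that produces longer and longer initial segments of `Y`
from initial segments of `X` witnesses that `X` computes `Y`. -/
theorem computes_of_computable {X Y : Cantor} {F : List Bool → List Bool} (hF : Computable F)
    (hp : ∀ s, F (seg X s) <+: seg Y (F (seg X s)).length)
    (hl : ∀ n, ∃ s, n < (F (seg X s)).length) : Computes X Y := by
  rw [Computes, TuringReducible, RecursiveIn.iff_nat]
  let dec : ℕ → List Bool := fun n => F ((Encodable.decode (α := List Bool) n).getD [])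
  have hdec : Computable dec :=
    hF.comp (Primrec.option_getD.comp Primrec.decode (Primrec.const [])).to_comp
  -- By truncated subtraction this vanishes exactly when the output is long enough to contain the
  -- queried position, so `rfind` finds a suitable stage.
  let test : ℕ → ℕ := fun n => (n.unpair.1 + 1) - (dec n.unpair.2).length
  have htest : Computable test :=
    Primrec.nat_sub.to_comp.comp
      (Primrec.succ.comp (Primrec.fst.comp Primrec.unpair)).to_comp
      (Primrec.list_length.to_comp.comp (hdec.comp (Primrec.snd.comp Primrec.unpair).to_comp))
  let bit : ℕ → ℕ := fun n => ((dec n.unpair.2).getD n.unpair.1 false).toNat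
  have hbit : Computable bit :=
    (Primrec.dom_bool Bool.toNat).to_comp.comp
      ((Primrec.list_getD false).to_comp.comp
        (hdec.comp (Primrec.snd.comp Primrec.unpair).to_comp)
        (Primrec.fst.comp Primrec.unpair).to_comp)
  have h0 : Nat.RecursiveIn {charFun X} fun n => Part.some n.unpair.1 :=
    recursiveIn_of_computable (Primrec.fst.comp Primrec.unpair).to_comp
  have h1 : Nat.RecursiveIn {charFun X} fun n => Part.some n.unpair.2 :=
    recursiveIn_of_computable (Primrec.snd.comp Primrec.unpair).to_comp
  have h2 := recursiveIn_pair h0 (recursiveIn_comp (recursiveIn_seg X) h1)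
  have h3 := Nat.RecursiveIn.rfind
    (recursiveIn_comp (recursiveIn_of_computable (O := {charFun X}) htest) h2)
  have h4 := recursiveIn_comp (recursiveIn_of_computable (O := {charFun X}) hbit) h2
  have h5 := Nat.RecursiveIn.comp h4 (Nat.RecursiveIn.pair
    (recursiveIn_of_computable (O := {charFun X}) Computable.id) h3)
  refine h5.of_eq fun n => ?_
  have hmem : ∃ s, s ∈ Nat.rfind fun k => (fun m => decide (m = 0)) <$>
      Part.some (test (Nat.pair (Nat.pair n k).unpair.1
        (Encodable.encode (seg X (Nat.pair n k).unpair.2)))) := by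
    obtain ⟨s, hs⟩ := hl n
    refine Part.dom_iff_mem.1 (Nat.rfind_dom.2 ⟨s, ?_, fun _ => trivial⟩)
    simp [test, dec]
    omega
  obtain ⟨s, hs⟩ := hmem
  have hspec := Nat.rfind_spec hs
  rw [Part.eq_some_iff.2 hs]
  have hn : n < (F (seg X s)).length := by
    simp [test, dec] at hspec
    omega
  have hval : (F (seg X s))[n] = Y n := by
    rw [(hp s).getElem hn, getElem_seg]
  simp [Seq.seq, bit, dec, charFun, hn, hval]

end Oracle

/-! ### Primitive recursiveness of the machine -/

section Computability

variable {α β : Type*} [Primcodable α] [Primcodable β]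

lemma primrec_pow : Primrec₂ fun a b : ℕ => a ^ b := Primrec₂.unpaired'.1 Nat.Primrec.pow

lemma primrec_filter {f : α → List β} {p : α → β → Bool} (hf : Primrec f) (hp : Primrec₂ p) :
    Primrec fun a => (f a).filter (p a) := by
  have h : Primrec fun a => (f a).filterMap fun b => bif p a b then some b else none :=
    Primrec.listFilterMap hf
      (Primrec.cond hp (Primrec.option_some.comp Primrec.snd) (Primrec.const none)).to₂
  refine h.of_eq fun a => ?_
  rw [← List.filterMap_eq_filter]
  congr 1
  funext b
  cases h : p a b <;> simp [Option.guard, h]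

lemma primrec_all {f : α → List β} {p : α → β → Bool} (hf : Primrec f) (hp : Primrec₂ p) :
    Primrec fun a => (f a).all (p a) := by
  have h : Primrec fun a => (f a).foldr (fun b acc => p a b && acc) true :=
    Primrec.list_foldr hf (Primrec.const true)
      (Primrec.and.comp (hp.comp Primrec.fst (Primrec.fst.comp Primrec.snd))
        (Primrec.snd.comp Primrec.snd)).to₂
  refine h.of_eq fun a => ?_
  induction f a with
  | nil => rfl
  | cons b l ih => simp [ih]

lemma primrec_strings : Primrec strings := by
  have h : Primrec (Nat.rec [[]] fun _ L => L.flatMap fun l => [l ++ [false], l ++ [true]] :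
      ℕ → List (List Bool)) := by
    refine Primrec.nat_rec₁ _ (Primrec.list_flatMap Primrec.snd ?_)
    have h1 (b : Bool) : Primrec fun p : (ℕ × List (List Bool)) × List Bool => p.2 ++ [b] :=
      Primrec.list_append.comp Primrec.snd (Primrec.const [b])
    exact (Primrec.list_cons.comp (h1 false)
      (Primrec.list_cons.comp (h1 true) (Primrec.const [])))
  refine h.of_eq fun n => ?_
  induction n with
  | zero => rfl
  | succ n ih => rw [strings, ← ih]

lemma primrec_isPrefix {f g : α → List Bool} (hf : Primrec f) (hg : Primrec g) :
    Primrec fun a => decide (f a = (g a).take (f a).length) :=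
  (Primrec.eq.comp hf (Primrec.list_take.comp (Primrec.list_length.comp hf) hg)).decide

lemma primrec_extensions : Primrec₂ extensions :=
  primrec_filter (primrec_strings.comp Primrec.snd)
    (primrec_isPrefix (Primrec.fst.comp Primrec.fst) Primrec.snd).to₂

lemma primrec_alive (hc : Primrec fun p : (ℕ × ℕ) × List Bool => T p.1.1 p.1.2 p.2) :
    Primrec₂ (alive T) := by
  refine primrec_all (p := fun (a : List Entry × List Bool) (x : Entry) => T x.req x.guess a.2)
    Primrec.fst ?_
  exact (hc.comp (Primrec.pair (Primrec.snd.comp (Primrec.fst.comp Primrec.snd))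
    (Primrec.snd.comp Primrec.fst))).to₂

lemma primrec_count (hc : Primrec fun p : (ℕ × ℕ) × List Bool => T p.1.1 p.1.2 p.2)
    {f : α → List Entry} {g : α → List Bool} {h : α → ℕ} (hf : Primrec f) (hg : Primrec g)
    (hh : Primrec h) : Primrec fun a => count T (f a) (g a) (h a) :=
  Primrec.list_length.comp (primrec_filter (primrec_strings.comp hh)
    (Primrec.and.comp (primrec_isPrefix (hg.comp Primrec.fst) Primrec.snd)
      ((primrec_alive hc).comp (hf.comp Primrec.fst) Primrec.snd)).to₂)

lemma primrec_base : Primrec Entry.base := Primrec.fst.comp Primrec.snd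

lemma primrec_loss : Primrec Entry.loss := Primrec.fst.comp (Primrec.snd.comp Primrec.snd)

lemma primrec_start : Primrec Entry.start := Primrec.snd.comp (Primrec.snd.comp Primrec.snd)

lemma primrec_mode : Primrec Entry.mode := Primrec.fst.comp Primrec.fst

lemma primrec_refuted (hc : Primrec fun p : (ℕ × ℕ) × List Bool => T p.1.1 p.1.2 p.2) :
    Primrec₂ (refuted T) := by
  have hl : Primrec fun p : List Entry × List Bool => p.2.length :=
    Primrec.list_length.comp Primrec.snd
  have hx : Primrec fun p : List Entry × List Bool => p.1.headI :=
    Primrec.list_headI.comp Primrec.fst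
  exact (Primrec.nat_lt.comp
    (Primrec.nat_mul.comp
      (primrec_count hc Primrec.fst
        (Primrec.list_take.comp (primrec_base.comp hx) Primrec.snd) hl)
      (primrec_pow.comp (Primrec.const 2) (primrec_loss.comp hx)))
    (primrec_pow.comp (Primrec.const 2) hl)).decide

lemma primrec_nextGuess : Primrec₂ nextGuess := by
  refine Primrec.pair (Primrec.pair ?_ (Primrec.pair ?_ ?_)) (Primrec.pair ?_ (Primrec.pair ?_ ?_))
  · exact primrec_mode.comp Primrec.fst
  · exact Primrec.fst.comp (Primrec.snd.comp (Primrec.fst.comp Primrec.fst))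
  · exact Primrec.succ.comp (Primrec.snd.comp (Primrec.snd.comp (Primrec.fst.comp Primrec.fst)))
  · exact primrec_base.comp Primrec.fst
  · exact primrec_loss.comp Primrec.fst
  · exact Primrec.snd

lemma primrec_revise (hc : Primrec fun p : (ℕ × ℕ) × List Bool => T p.1.1 p.1.2 p.2) :
    Primrec₂ (revise T) := by
  let A := (List Entry × List Bool) × Entry × List Entry × Bool
  have hν : Primrec fun p : A => p.1.2 := Primrec.snd.comp Primrec.fst
  have hx : Primrec fun p : A => p.2.1 := Primrec.fst.comp Primrec.snd
  have hR : Primrec fun p : A => p.2.2.1 := Primrec.fst.comp (Primrec.snd.comp Primrec.snd)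
  have hb : Primrec fun p : A => p.2.2.2 := Primrec.snd.comp (Primrec.snd.comp Primrec.snd)
  have hacc : Primrec fun p : A => p.2.2 := Primrec.snd.comp Primrec.snd
  have hcons : Primrec fun p : A => p.2.1 :: p.2.2.1 := Primrec.list_cons.comp hx hR
  refine Primrec.list_foldr Primrec.fst (Primrec.const ([], false)) (Primrec.to₂ (f := fun p : A =>
    if p.2.2.2 = true then p.2.2
    else if refuted T (p.2.1 :: p.2.2.1) p.1.2 = true then
      (nextGuess p.2.1 p.1.2.length :: p.2.2.1, true)
    else (p.2.1 :: p.2.2.1, false)) ?_)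
  refine Primrec.ite (Primrec.eq.comp hb (Primrec.const true)) hacc
    (Primrec.ite (Primrec.eq.comp ((primrec_refuted hc).comp hcons hν) (Primrec.const true)) ?_ ?_)
  · exact Primrec.pair (Primrec.list_cons.comp
      (primrec_nextGuess.comp hx (Primrec.list_length.comp hν)) hR) (Primrec.const true)
  · exact Primrec.pair hcons (Primrec.const false)

lemma primrec_depth : Primrec depth :=
  Primrec.nat_add.comp (primrec_loss.comp Primrec.list_headI)
    (primrec_start.comp Primrec.list_headI)

lemma primrec_candidates (hc : Primrec fun p : (ℕ × ℕ) × List Bool => T p.1.1 p.1.2 p.2) :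
    Primrec₂ (candidates T) := by
  have hd : Primrec fun p : List Entry × List Bool => depth p.1 := primrec_depth.comp Primrec.fst
  have hl : Primrec fun p : List Entry × List Bool => p.2.length :=
    Primrec.list_length.comp Primrec.snd
  refine primrec_filter
    (primrec_extensions.comp (Primrec.list_take.comp
      (primrec_start.comp (Primrec.list_headI.comp Primrec.fst)) Primrec.snd)
      (Primrec.succ.comp hd)) (Primrec₂.mk ?_)
  refine (Primrec.nat_le.comp (primrec_pow.comp (Primrec.const 2) (hl.comp Primrec.fst))
    (Primrec.nat_mul.comp (primrec_count hc (Primrec.fst.comp Primrec.fst) Primrec.snd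
      (hl.comp Primrec.fst)) (primrec_pow.comp (Primrec.const 2) ?_))).decide
  exact Primrec.succ.comp (Primrec.succ.comp
    (Primrec.nat_mul.comp (Primrec.const 2) (hd.comp Primrec.fst)))

lemma primrec_newEntry {f : α → Bool} {g : α → List Entry} {h : α → ℕ} (hf : Primrec f)
    (hg : Primrec g) (hh : Primrec h) : Primrec fun a => newEntry (f a) (g a) (h a) := by
  have hm : Primrec fun a => (g a).headI.mode := primrec_mode.comp (Primrec.list_headI.comp hg)
  refine Primrec.pair (Primrec.pair ?_ (Primrec.pair ?_ (Primrec.const 0)))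
    (Primrec.pair hh (Primrec.pair ?_ hh))
  · exact Primrec.cond hf (Primrec.const 0) (Primrec.succ.comp hm)
  · exact Primrec.cond hf (Primrec.pred.comp hm) (Primrec.const 0)
  · exact Primrec.succ.comp (Primrec.nat_add.comp (Primrec.succ.comp (Primrec.succ.comp
      (Primrec.nat_mul.comp (Primrec.const 2) (primrec_depth.comp hg)))) hh)

lemma primrec_emitted : Primrec₂ emitted := by
  refine Primrec.ite (PrimrecPred.and (Primrec.eq.comp Primrec.fst (Primrec.const true))
    (Primrec.nat_le.comp Primrec.snd (Primrec.const 1))) ?_ (Primrec.const [])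
  exact Primrec.list_cons.comp (Primrec.eq.comp Primrec.snd (Primrec.const 1)).decide
    (Primrec.const [])

lemma primrec_getLast? : Primrec (List.getLast? : List β → Option β) :=
  (Primrec.list_head?.comp Primrec.list_reverse).of_eq fun l => by simp

lemma primrec_decoded (hc : Primrec fun p : (ℕ × ℕ) × List Bool => T p.1.1 p.1.2 p.2) :
    Primrec₂ (decoded T) := by
  have ht : Primrec fun p : List Entry × List Bool => some (p.2.take (depth p.1 + 1)) :=
    Primrec.option_some.comp (Primrec.list_take.comp
      (Primrec.succ.comp (primrec_depth.comp Primrec.fst)) Primrec.snd)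
  exact Primrec.ite (Primrec.eq.comp (Primrec.list_head?.comp (primrec_candidates hc)) ht)
    (Primrec.const _) (Primrec.ite
      (Primrec.eq.comp (primrec_getLast?.comp (primrec_candidates hc)) ht)
      (Primrec.const _) (Primrec.const _))

lemma primrec_step (hc : Primrec fun p : (ℕ × ℕ) × List Bool => T p.1.1 p.1.2 p.2) :
    Primrec₂ (step T) := by
  let A := (List Entry × List Bool) × List Bool
  have hr : Primrec fun p : A => revise T p.1.1 p.2 :=
    (primrec_revise hc).comp (Primrec.fst.comp Primrec.fst) Primrec.snd
  have hS : Primrec fun p : A × Bool => p.1.1.1 :=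
    Primrec.fst.comp (Primrec.fst.comp Primrec.fst)
  have ho : Primrec fun p : A × Bool => p.1.1.2 :=
    Primrec.snd.comp (Primrec.fst.comp Primrec.fst)
  have hl : Primrec fun p : A × Bool => p.1.2.length :=
    Primrec.list_length.comp (Primrec.snd.comp Primrec.fst)
  have hopt : Primrec fun p : A => (decoded T p.1.1 p.2).elim p.1 fun b =>
      (newEntry b p.1.1 p.2.length :: p.1.1, p.1.2 ++ emitted b p.1.1.headI.mode) := by
    have h1 : Primrec fun p : A => (Option.casesOn (decoded T p.1.1 p.2) p.1 fun b =>
        (newEntry b p.1.1 p.2.length :: p.1.1, p.1.2 ++ emitted b p.1.1.headI.mode) :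
        List Entry × List Bool) := by
      refine Primrec.option_casesOn
        ((primrec_decoded hc).comp (Primrec.fst.comp Primrec.fst) Primrec.snd) Primrec.fst
        (Primrec.pair (Primrec.list_cons.comp (primrec_newEntry Primrec.snd hS hl) hS)
          (Primrec.list_append.comp ho (primrec_emitted.comp Primrec.snd
            (primrec_mode.comp (Primrec.list_headI.comp hS))))).to₂
    refine h1.of_eq fun p => ?_
    cases decoded T p.1.1 p.2 <;> rfl
  exact Primrec.ite (Primrec.eq.comp (Primrec.snd.comp hr) (Primrec.const true))
    (Primrec.pair (Primrec.fst.comp hr) (Primrec.snd.comp Primrec.fst)) hopt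

lemma primrec_run (hc : Primrec fun p : (ℕ × ℕ) × List Bool => T p.1.1 p.1.2 p.2) :
    Primrec (run T) := by
  let A := List Bool × (List Bool × List Entry × List Bool) × Bool
  have hσ : Primrec fun p : A => p.2.1.1 ++ [p.2.2] :=
    Primrec.list_append.comp (Primrec.fst.comp (Primrec.fst.comp Primrec.snd))
      (Primrec.list_cons.comp (Primrec.snd.comp Primrec.snd) (Primrec.const []))
  exact Primrec.snd.comp (Primrec.list_foldl Primrec.id (Primrec.const _)
    (Primrec.pair hσ ((primrec_step hc).comp
      (Primrec.snd.comp (Primrec.fst.comp Primrec.snd)) hσ)).to₂)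

end Computability

/-! ### A universal family of trees for `Π⁰₂` sets -/

open Nat.Partrec in
/-- The code with index `e` enumerates the pair `(j, σ)` within `s` steps. -/
def enumerated (e s : ℕ) (p : ℕ × List Bool) : Bool :=
  (Code.evaln s (Denumerable.ofNat Code e) (Encodable.encode p)).isSome

/-- The universal family of trees: for `e + 1` and `n`, the strings that are not yet seen to lie
in all of the first `n + 1` open sets of the `e`-th uniformly effectively open sequence. -/
def universalTree (e n : ℕ) (ν : List Bool) : Bool :=
  decide (e = 0) || !((List.range (n + 1)).all fun j =>
    !((List.range (ν.length + 1)).all fun i => !enumerated (e - 1) ν.length (j, ν.take i)))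

lemma universalTree_succ {e n : ℕ} {ν : List Bool} :
    universalTree (e + 1) n ν = true ↔
      ∃ j ≤ n, ∀ σ, σ <+: ν → enumerated e ν.length (j, σ) = false := by
  have h (j : ℕ) : (∀ i < ν.length + 1, enumerated e ν.length (j, ν.take i) = false) ↔
      ∀ σ, σ <+: ν → enumerated e ν.length (j, σ) = false := by
    constructor
    · intro h σ hσ
      rw [List.prefix_iff_eq_take.1 hσ]
      exact h _ (Nat.lt_succ_of_le hσ.length_le)
    · intro h i _
      exact h _ (List.take_prefix _ _)
  simp only [← h]
  simp [universalTree]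

lemma enumerated_mono {e s t : ℕ} (h : s ≤ t) {p : ℕ × List Bool}
    (hp : enumerated e s p = true) : enumerated e t p = true := by
  rw [enumerated, Option.isSome_iff_exists] at hp ⊢
  exact hp.imp fun _ hx => Nat.Partrec.Code.evaln_mono h hx

lemma treeFamily_universalTree : TreeFamily universalTree where
  zero n σ := by simp [universalTree]
  mono e n m σ h ht := by
    cases e with
    | zero => simp [universalTree]
    | succ e =>
      rw [universalTree_succ] at ht ⊢
      obtain ⟨j, hj, h'⟩ := ht
      exact ⟨j, hj.trans h, h'⟩
  closed e n σ τ h ht := by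
    cases e with
    | zero => simp [universalTree]
    | succ e =>
      rw [universalTree_succ] at ht ⊢
      obtain ⟨j, hj, h'⟩ := ht
      refine ⟨j, hj, fun ρ hρ => ?_⟩
      have := h' ρ (hρ.trans h)
      rw [← Bool.not_eq_true] at this ⊢
      exact fun hc => this (enumerated_mono h.length_le hc)

lemma primrec_enumerated : Primrec fun p : (ℕ × ℕ) × ℕ × List Bool =>
    enumerated p.1.1 p.1.2 p.2 :=
  Primrec.option_isSome.comp (Nat.Partrec.Code.primrec_evaln.comp
    (Primrec.pair (Primrec.pair (Primrec.snd.comp Primrec.fst)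
      ((Primrec.ofNat _).comp (Primrec.fst.comp Primrec.fst)))
      (Primrec.encode.comp Primrec.snd)))

lemma primrec_universalTree :
    Primrec fun p : (ℕ × ℕ) × List Bool => universalTree p.1.1 p.1.2 p.2 := by
  let A := (ℕ × ℕ) × List Bool
  have hlen : Primrec fun p : A => p.2.length := Primrec.list_length.comp Primrec.snd
  have he : Primrec fun p : A => p.1.1 := Primrec.fst.comp Primrec.fst
  have hn : Primrec fun p : A => p.1.2 := Primrec.snd.comp Primrec.fst
  refine Primrec.or.comp (Primrec.eq.comp he (Primrec.const 0)).decide (Primrec.not.comp ?_)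
  refine primrec_all (Primrec.list_range.comp (Primrec.succ.comp hn)) (Primrec₂.mk ?_)
  refine Primrec.not.comp (primrec_all (α := A × ℕ) (p := fun q i =>
    !enumerated (q.1.1.1 - 1) q.1.2.length (q.2, q.1.2.take i))
    (Primrec.list_range.comp (Primrec.succ.comp (hlen.comp Primrec.fst))) (Primrec₂.mk ?_))
  refine Primrec.not.comp (primrec_enumerated.comp (Primrec.pair (Primrec.pair ?_ ?_)
    (Primrec.pair ?_ ?_)))
  · exact Primrec.pred.comp (he.comp (Primrec.fst.comp Primrec.fst))
  · exact hlen.comp (Primrec.fst.comp Primrec.fst)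
  · exact Primrec.snd.comp Primrec.fst
  · exact Primrec.list_take.comp Primrec.snd
      (Primrec.snd.comp (Primrec.fst.comp Primrec.fst))

lemma exists_enumerated_iff {W : ℕ × List Bool → Prop} (hW : REPred W) :
    ∃ e, ∀ p, W p ↔ ∃ s, enumerated e s p = true := by
  obtain ⟨c, hc⟩ := Nat.Partrec.Code.exists_code.1 hW
  refine ⟨Encodable.encode c, fun p => ?_⟩
  simp only [enumerated, Denumerable.ofNat_encode, Option.isSome_iff_exists]
  rw [exists_comm]
  have h1 (x : ℕ) : (∃ s, c.evaln s (Encodable.encode p) = some x) ↔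
      x ∈ c.eval (Encodable.encode p) := Nat.Partrec.Code.evaln_complete.symm
  simp only [h1, hc]
  simp

/-- Membership in finitely many of the open sets is witnessed by finitely many strings, all
enumerated by one sufficiently late stage. Thus the `e`-th `Π⁰₂` set is exactly what leaves every
tree of family `e + 1`. -/
lemma mem_iff_universalTree {e : ℕ} {W : ℕ → List Bool → Prop}
    (h : ∀ j σ, W j σ ↔ ∃ s, enumerated e s (j, σ) = true) (X : Cantor) :
    (∀ j, ∃ σ, W j σ ∧ X ∈ basicOpen σ) ↔
      ∀ n, ∃ s, universalTree (e + 1) n (seg X s) = false := by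
  constructor
  · intro hX n
    simp only [h] at hX
    choose σ hσ hXσ using hX
    choose t ht using hσ
    let s := (Finset.range (n + 1)).sup fun j => max (t j) (σ j).length
    refine ⟨s, ?_⟩
    rw [← Bool.not_eq_true, universalTree_succ]
    rintro ⟨j, hj, hj'⟩
    have hs : max (t j) (σ j).length ≤ s :=
      Finset.le_sup (f := fun j => max (t j) (σ j).length) (by simpa [Nat.lt_succ_iff] using hj)
    have h1 := hj' (σ j) ((mem_basicOpen_iff_prefix ((le_max_right _ _).trans hs)).1 (hXσ j))
    rw [length_seg, enumerated_mono ((le_max_left _ _).trans hs) (ht j)] at h1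
    exact absurd h1 (by simp)
  · intro hX j
    obtain ⟨s, hs⟩ := hX j
    rw [← Bool.not_eq_true, universalTree_succ] at hs
    push Not at hs
    obtain ⟨σ, hσ, hσ'⟩ := hs j le_rfl
    refine ⟨σ, (h j σ).2 ⟨_, by simpa using hσ'⟩, ?_⟩
    exact (mem_basicOpen_iff_prefix (by simpa using hσ.length_le)).2 hσ

/-- A sequence trapped in a tree of every null family is weakly 2-random. -/
lemma weaklyTwoRandom_of_trapped {X : Cantor}
    (h : ∀ e, NullIndex universalTree (e + 1) →
      ∃ n, ∀ s, universalTree (e + 1) n (seg X s) = true) : WeaklyTwoRandom X := by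
  rintro A ⟨U, ⟨W, hW, hU⟩, rfl⟩ hA hX
  obtain ⟨e, he⟩ := exists_enumerated_iff hW
  have hmem (Z : Cantor) := mem_iff_universalTree (W := W) (fun j σ => he (j, σ)) Z
  have hset (Z : Cantor) : Z ∈ ⋂ n, U n ↔ ∀ j, ∃ σ, W j σ ∧ Z ∈ basicOpen σ := by
    simp [hU]
  have heq : {Z | ∀ n, ∃ s, universalTree (e + 1) n (seg Z s) = false} = ⋂ n, U n := by
    ext Z
    exact (hmem Z).symm.trans (hset Z).symm
  obtain ⟨n, hn⟩ := h e (by rw [NullIndex, heq, hA])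
  obtain ⟨s, hs⟩ := (hmem X).1 ((hset X).1 hX) n
  rw [hn s] at hs
  exact absurd hs (by simp)

/-! ### Comeager sets and the conclusion -/

lemma exists_dense_open_sequence {G : Set Cantor} (hG : G ∈ residual Cantor) :
    ∃ U : ℕ → Set Cantor, (∀ n, IsOpen (U n)) ∧ (∀ n, Dense (U n)) ∧ ⋂ n, U n ⊆ G := by
  obtain ⟨S, hS, hd, hc, hsub⟩ := mem_residual_iff.1 hG
  -- Adding the whole space makes the family nonempty, hence the range of a sequence.
  obtain ⟨U, hU⟩ := (hc.insert Set.univ).exists_eq_range (Set.insert_nonempty _ _)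
  have hmem (n : ℕ) : U n ∈ insert Set.univ S := hU ▸ Set.mem_range_self n
  refine ⟨U, fun n => ?_, fun n => ?_, fun Z hZ => hsub fun V hV => ?_⟩
  · rcases hmem n with h | h
    · rw [h]; exact isOpen_univ
    · exact hS _ h
  · rcases hmem n with h | h
    · rw [h]; exact dense_univ
    · exact hd _ h
  · obtain ⟨n, rfl⟩ : V ∈ Set.range U := hU ▸ Set.mem_insert_of_mem _ hV
    exact Set.mem_iInter.1 hZ n

end CantorSpace

theorem mainTheorem4 (G : Set CantorSpace.Cantor) (hG : G ∈ residual CantorSpace.Cantor) :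
    ∃ X : CantorSpace.Cantor, CantorSpace.WeaklyTwoRandom X ∧
      ∃ Y ∈ G, CantorSpace.Computes X Y := by
  obtain ⟨U, hU, hd, hsub⟩ := CantorSpace.exists_dense_open_sequence hG
  obtain ⟨X, Y, h1, h2, h3, h4⟩ :=
    CantorSpace.exists_trapped_generic CantorSpace.treeFamily_universalTree hU hd
  refine ⟨X, CantorSpace.weaklyTwoRandom_of_trapped h1, Y, hsub (Set.mem_iInter.2 h2), ?_⟩
  exact CantorSpace.computes_of_computable
    (Primrec.snd.comp (CantorSpace.primrec_run CantorSpace.primrec_universalTree)).to_comp h3 h4
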